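/- Let $(\Omega,\mathcal F,\{\mathcal F_t\}_{t\ge 0},\mathbb P)$ be a filtered probability space satisfying the usual conditions, let $u\ge 0$, $c\in\mathbb R$, $\beta>0$ and $\lambda>a>0$, and let $F_U,F_Y$ be probability distributions on $(0,\infty)$, with $U\sim F_U$, $Y\sim F_Y$. Let $0<T_1<T_2<\cdots\to\infty$ be arrival times, $N_t=\#\{i:T_i\le t\}$, with claims $U_i$ and shocks $Y_i$, where $T_i$ is an $\{\mathcal F_t\}$-stopping time and $U_i$, $Y_i$ are $\mathcal F_{T_i}$-measurable. Put $$\lambda_t=a+(\lambda-a)e^{-\beta t}+\sum_{i=1}^{N_t}Y_ie^{-\beta(t-T_i)},\qquad X_t=u+ct-\sum_{i=1}^{N_t}U_i .$$ The $Y_i$ are i.i.d. with law $F_Y$, the $U_i$ are i.i.d. with law $F_U$ and independent of $(T_i,Y_i)_{i\ge 1}$, and $N$ has $\mathcal F_t$-intensity $\lambda_t$ with marks drawn independently of the past; that is, the marked point process $\sum_i\delta_{(T_i,U_i,Y_i)}$ has $\mathcal F_t$-compensator $\lambda_t\,dt\,F_U(dx)\,F_Y(dy)$. Write $M_U(s)=\mathbb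 E[e^{sU}]$ and $M_Y(s)=\mathbb E[e^{sY}]$. Assume: $\mathbb E[Y]<\beta$; $c>\frac{a\beta\,\mathbb E[U]}{\beta-\mathbb E[Y]}$; $F_U$ is absolutely continuous; and there are $s_U,s_Y\in(0,\infty]$ such that $M_U(s)<\infty$ for $s<s_U$, $M_U(s)\to\infty$ as $s\uparrow s_U$, and likewise for $M_Y$ and $s_Y$. Let $\alpha(r)$ be the maximal real solution $\alpha$ of $$\alpha\beta+M_U(r)M_Y(-\alpha)-1=0$$ (with both moment generating functions finite), whenever a maximal solution exists, and let $\theta(r)=-cr-\alpha(r)\beta a$. Assume that $R>0$ satisfies $\theta(R)=0$ (with $\alpha(R)$ defined) and that $\varepsilon>0$ is such that $\alpha(R+\varepsilon)$ is defined and $M_U(R+\varepsilon)$, $M_Y(-\alpha(R+\varepsilon))$ are finite. Then $\alpha(r)$ is defined for all $r\le R+\varepsilon$, and for the process $$M^{(r)}_t=\exp(ru+\alpha(r)\lambda)\,\exp\bigl(-rX_t-\alpha(r)\lambda_t-\theta(r)t\bigr),\qquad t\ge 0,$$ the following hold. (i) For $0\le r\le R+\varepsilon$, $M^{(r)}$ is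 a non-negative local martingale (with almost surely càdlàg paths). (ii) For every $r<R+\varepsilon$ (in particular for $0\le r<R+\varepsilon$), $M^{(r)}$ is a true martingale with $\mathbb E[M^{(r)}_t]=1$ for all $t\ge 0$. (iii) For every $r<R+\varepsilon$, $M^{(r)}$ defines a change of measure: there is a unique family $(\mathbb Q^{(r)}_t)_{t\ge0}$ of probability measures $\mathbb Q^{(r)}_t$ on $\mathcal F_t$ with $\mathbb Q^{(r)}_t[A]=\mathbb E[\mathbf 1_A M^{(r)}_t]$ for all $A\in\mathcal F_t$ and $\mathbb Q^{(r)}_t|_{\mathcal F_s}=\mathbb Q^{(r)}_s$ for $s\le t$. -/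

import Mathlib

open MeasureTheory ProbabilityTheory Filter Topology
open scoped NNReal ENNReal

noncomputable section

namespace HawkesRisk

/-- The data of the Markovian Hawkes risk model: initial capital `u`, premium rate `c`,
baseline intensity `a`, decay parameter `β`, initial intensity `lam`, and the distributions
`FU` of the claim sizes and `FY` of the shocks. -/
structure Params where
  u : ℝ
  c : ℝ
  a : ℝ
  β : ℝ
  lam : ℝ
  FU : Measure ℝ
  FY : Measure ℝ

/-- The moment generating function of the distribution `F` is finite on `(-∞, s₀)` for some
`s₀ ∈ (0, ∞]` and tends to `∞` at `s₀`. For `s₀ = ∞` the filter below is `atTop`. -/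
def HasSteepMGF (F : Measure ℝ) : Prop :=
  ∃ s₀ : EReal, 0 < s₀ ∧ (∀ s : ℝ, (s : EReal) < s₀ → s ∈ integrableExpSet id F) ∧
    Tendsto (fun s : ℝ => mgf id F s) (comap (fun s : ℝ => (s : EReal)) (𝓝[<] s₀)) atTop

/-- The requirements on the parameters: positivity, stability of the Hawkes process, the net
profit condition, and the light-tail conditions on shocks and claims. -/
structure Params.Admissible (p : Params) : Prop where
  u_nonneg : 0 ≤ p.u
  a_pos : 0 < p.a
  a_lt_lam : p.a < p.lam
  β_pos : 0 < p.β
  prob_FU : IsProbabilityMeasure p.FU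
  prob_FY : IsProbabilityMeasure p.FY
  FU_pos : ∀ᵐ x ∂p.FU, 0 < x
  FY_pos : ∀ᵐ y ∂p.FY, 0 < y
  FY_integrable : Integrable (fun y : ℝ => y) p.FY
  mean_lt : ∫ y, y ∂p.FY < p.β
  net_profit : p.a * p.β * (∫ x, x ∂p.FU) / (p.β - ∫ y, y ∂p.FY) < p.c
  FY_steep : HasSteepMGF p.FY
  FU_abs_cont : p.FU ≪ volume
  FU_steep : HasSteepMGF p.FU

/-- The real solutions `α` of `α β + M_U(r) M_Y(-α) - 1 = 0`; the two moment generating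
functions are required to be finite there. -/
def Params.roots (p : Params) (r : ℝ) : Set ℝ :=
  {α | r ∈ integrableExpSet id p.FU ∧ -α ∈ integrableExpSet id p.FY ∧
    α * p.β + mgf id p.FU r * mgf id p.FY (-α) - 1 = 0}

/-- `α(r)`: the maximal solution. It is meaningful when `p.AlphaDefined r`. -/
def Params.alpha (p : Params) (r : ℝ) : ℝ := sSup (p.roots r)

/-- `α(r)` is well defined: the set of solutions has a greatest element, namely `α(r)`. -/
def Params.AlphaDefined (p : Params) (r : ℝ) : Prop := IsGreatest (p.roots r) (p.alpha r)

/-- `θ(r) = -c r - α(r) β a`. -/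
def Params.theta (p : Params) (r : ℝ) : ℝ := -p.c * r - p.alpha r * p.β * p.a

/-- `R` is a positive solution of `θ(R) = 0`, and `ε > 0` is such that `α(R + ε)` is defined and
`M_U(R + ε)` and `M_Y(-α(R + ε))` are finite. -/
structure Params.IsAdjustment (p : Params) (R ε : ℝ) : Prop where
  R_pos : 0 < R
  alpha_R : p.AlphaDefined R
  theta_R : p.theta R = 0
  ε_pos : 0 < ε
  alpha_add : p.AlphaDefined (R + ε)
  mgf_U : R + ε ∈ integrableExpSet id p.FU
  mgf_Y : -p.alpha (R + ε) ∈ integrableExpSet id p.FY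

section Model

variable {Ω : Type*}

/-- The counting process `N_t` of the arrival times `T 0 < T 1 < ⋯`. -/
def count (T : ℕ → Ω → ℝ≥0) (t : ℝ≥0) (ω : Ω) : ℕ := {n | T n ω ≤ t}.ncard

/-- `λ_t = a + (λ - a) e^{-β t} + ∑_{i ≤ N_t} Y_i e^{-β (t - T_i)}` (indices start at `0`). -/
def intensity (p : Params) (T : ℕ → Ω → ℝ≥0) (Y : ℕ → Ω → ℝ) (t : ℝ≥0) (ω : Ω) : ℝ :=
  p.a + (p.lam - p.a) * Real.exp (-p.β * t) +
    ∑ i ∈ Finset.range (count T t ω), Y i ω * Real.exp (-p.β * ((t : ℝ) - T i ω))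

/-- `X_t = u + c t - ∑_{i ≤ N_t} U_i` (indices start at `0`). -/
def surplus (p : Params) (T : ℕ → Ω → ℝ≥0) (U : ℕ → Ω → ℝ) (t : ℝ≥0) (ω : Ω) : ℝ :=
  p.u + p.c * t - ∑ i ∈ Finset.range (count T t ω), U i ω

/-- `M_t^{(r)} = exp(r u + α(r) λ) exp(-r X_t - α(r) λ_t - θ(r) t)`. -/
def expMart (p : Params) (T : ℕ → Ω → ℝ≥0) (U Y : ℕ → Ω → ℝ) (r : ℝ) (t : ℝ≥0) (ω : Ω) : ℝ :=
  Real.exp (r * p.u + p.alpha r * p.lam) *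
    Real.exp (-r * surplus p T U t ω - p.alpha r * intensity p T Y t ω - p.theta r * t)

variable {mΩ : MeasurableSpace Ω}

/-- The usual conditions: right-continuity, and `ℱ 0` contains all `P`-null sets. -/
structure UsualConditions (P : Measure Ω) (ℱ : Filtration ℝ≥0 mΩ) : Prop where
  right_cont : ℱ.IsRightContinuous
  complete : ∀ s : Set Ω, P s = 0 → MeasurableSet[ℱ 0] s

/-- On the filtered probability space, `T` are the arrival times of a (simple, non-explosive)
Markovian Hawkes process with shocks `Y` and claims `U`: the claims are i.i.d. with law `FU` and
independent of the arrivals and shocks, the shocks are i.i.d. with law `FY`, and arrivals occur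
with intensity `λ_t` relative to `ℱ`, their marks being drawn from `FU ⊗ FY` independently of the
past. The last clause is the usual formulation of this through predictable integrands: the marked
point process `∑ δ_{(T n, U n, Y n)}` has the `ℱ`-compensator `λ_t dt FU(du) FY(dy)`. -/
structure IsHawkesModel (p : Params) (P : Measure Ω) (ℱ : Filtration ℝ≥0 mΩ)
    (T : ℕ → Ω → ℝ≥0) (U Y : ℕ → Ω → ℝ) : Prop where
  first_pos : ∀ᵐ ω ∂P, 0 < T 0 ω
  strictMono : ∀ᵐ ω ∂P, StrictMono (fun n => T n ω)
  tendsto : ∀ᵐ ω ∂P, Tendsto (fun n => T n ω) atTop atTop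
  stopping : ∀ n, IsStoppingTime ℱ (fun ω => (T n ω : WithTop ℝ≥0))
  claim_meas : ∀ n, Measurable[(stopping n).measurableSpace] (U n)
  shock_meas : ∀ n, Measurable[(stopping n).measurableSpace] (Y n)
  claim_law : ∀ n, P.map (U n) = p.FU
  shock_law : ∀ n, P.map (Y n) = p.FY
  claim_indep : iIndepFun U P
  shock_indep : iIndepFun Y P
  claim_indep_arrivals :
    IndepFun (fun ω n => U n ω) (fun ω => ((fun n => T n ω), (fun n => Y n ω))) P
  compensator : ∀ H : (ℝ≥0 × Ω) × (ℝ × ℝ) → ℝ≥0∞,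
    @Measurable _ _ (ℱ.predictable.prod inferInstance) _ H →
    ∫⁻ ω, ∑' n, H ((T n ω, ω), (U n ω, Y n ω)) ∂P =
      ∫⁻ ω, (∫⁻ t in Set.Ici (0 : ℝ), ENNReal.ofReal (intensity p T Y t.toNNReal ω) *
        (∫⁻ x, (∫⁻ y, H ((t.toNNReal, ω), (x, y)) ∂p.FY) ∂p.FU)) ∂P

/-- Local martingale: adapted, almost surely càdlàg, and a martingale along a localizing
sequence of stopping times. -/
structure IsLocalMartingale (Z : ℝ≥0 → Ω → ℝ) (ℱ : Filtration ℝ≥0 mΩ) (P : Measure Ω) :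
    Prop where
  adapted : StronglyAdapted ℱ Z
  cadlag : ∀ᵐ ω ∂P, ∀ t, ContinuousWithinAt (fun s => Z s ω) (Set.Ici t) t ∧
    ∃ l, Tendsto (fun s => Z s ω) (𝓝[<] t) (𝓝 l)
  locally_martingale : Locally (fun W => Martingale W ℱ P) ℱ Z P

/-- `Q` is the change of measure with density process `Z`: for every `t`, `Q t` is a probability
measure on `ℱ t` with `Q t A = E[1_A Z_t]`, and `Q t` restricts to `Q s` for `s ≤ t`. -/
structure IsChangeOfMeasure (Z : ℝ≥0 → Ω → ℝ) (ℱ : Filtration ℝ≥0 mΩ) (P : Measure Ω)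
    (Q : ∀ t : ℝ≥0, @Measure Ω (ℱ t)) : Prop where
  prob : ∀ t, IsProbabilityMeasure (Q t)
  density : ∀ t (A : Set Ω), MeasurableSet[ℱ t] A →
    Q t A = ∫⁻ ω in A, ENNReal.ofReal (Z t ω) ∂P
  consistent : ∀ s t, ∀ hst : s ≤ t, (Q t).trim (ℱ.mono hst) = Q s

end Model

end HawkesRisk

end

/-! ### Steep moment generating functions and the maximal root -/

namespace HawkesRisk

/-! Write `M` for the exponential process, `Λ` for the intensity and `α = α(r)`. Between arrivals
`M` solves a linear ODE: `θ(r)` is chosen so that the logarithmic derivative of `M` is `αβΛ`. An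
arrival multiplies `M` by `exp(rU - αY)`, whose mean is `κ = M_U(r) M_Y(-α)`. The equation for `α`
says `αβ + κ = 1`, so drift and compensated jumps cancel. Only mass escaping through infinitely many
arrivals could spoil the martingale property.

This is made exact without stochastic calculus. Trajectories are split by the number `k` of arrivals
so far, and on the `k`-th stage the compensator formula is used twice: for the value of `M` after
the arrival and for the value before it (`lintegral_jumpTerm`, `lintegral_jumpTerm_unmarked`).
Combined with the pathwise identity `expVal_balance`, this shows that on every event of `ℱ s` the
mass in stage `k` at time `s` plus the mass entering it during `(s, t]` equals the mass in it at `t`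
plus the mass leaving it (`stage_expVal`). Mass leaving stage `k` enters stage `k + 1`, so the
stages telescope (`sum_aliveTerm`), and the only defect is the mass carried past the `n`-th arrival
before `t`.

This defect vanishes as `n → ∞` because the tilted law does not explode. The Lyapunov function is `M
Λ exp(-γu)`. Let `κ'` be the mean of the jump factor times the shock. Under the tilted law arrivals
have rate `κΛ`, and shocks raise `Λ` at mean rate `κ'Λ`, while mean reversion only lowers it. With
`γ = κ + κ'` the discounted intensity falls fast enough to pay `exp(-γt)` for each arrival before
`t`, so the expected number of these arrivals is at most `λ exp(γt)` (`tsum_startTerm_ne_top`).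
Integrability behind `κ'` comes from steepness, which makes the domain of `M_Y` open.

The argument needs only that `α(r)` is defined, which passes from `R + ε` to all smaller `r` by the
intermediate value theorem (`alphaDefined_of_le`). -/

lemma HasSteepMGF.mem_interior {F : Measure ℝ} (hF : HasSteepMGF F) (hpos : ∀ᵐ x ∂F, 0 < x)
    {s : ℝ} (hs : s ∈ integrableExpSet id F) : s ∈ interior (integrableExpSet id F) := by
  obtain ⟨s₀, hs₀, hint, htend⟩ := hF
  have hlt : (s : EReal) < s₀ := by
    -- If `s` were at or beyond `s₀`, positivity would bound the generating function below `s₀` by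
    -- its value at `s`, against the blow-up at `s₀`.
    by_contra! hle
    have hev : ∀ᶠ s' : ℝ in comap (fun s : ℝ => (s : EReal)) (𝓝[<] (s₀ : EReal)), (s' : EReal) < s₀ :=
      tendsto_comap.eventually (self_mem_nhdsWithin (a := s₀) (s := Set.Iio s₀))
    have hne : (comap (fun s : ℝ => (s : EReal)) (𝓝[<] (s₀ : EReal))).NeBot := by
      refine comap_neBot fun V hV => ?_
      obtain ⟨l, hl, hsub⟩ := (mem_nhdsLT_iff_exists_Ioo_subset' hs₀).1 hV
      obtain ⟨x, hx⟩ := EReal.lt_iff_exists_real_btwn.1 hl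
      exact ⟨x, hsub hx⟩
    obtain ⟨s', h1, h2⟩ := ((htend.eventually_gt_atTop (mgf id F s)).and hev).exists
    refine h1.not_ge (integral_mono_ae (hint s' h2) hs ?_)
    filter_upwards [hpos] with x hx
    have : s' ≤ s := EReal.coe_le_coe_iff.1 (h2.le.trans hle)
    exact Real.exp_le_exp.2 (mul_le_mul_of_nonneg_right this hx.le)
  refine _root_.mem_interior.2 ⟨{x : ℝ | (x : EReal) < s₀}, hint, ?_, hlt⟩
  exact isOpen_Iio.preimage continuous_coe_real_ereal

/-- A point at or beyond `s₀` lies between `0` and `s`, and the domain is convex. -/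
lemma HasSteepMGF.mem_of_le {F : Measure ℝ} (hF : HasSteepMGF F)
    {s s' : ℝ} (hs : s ∈ integrableExpSet id F) (hle : s' ≤ s) :
    s' ∈ integrableExpSet id F := by
  obtain ⟨s₀, hs₀, hint, -⟩ := hF
  rcases lt_or_ge (s' : EReal) s₀ with h | h
  · exact hint s' h
  · have h0 : (0 : ℝ) ∈ integrableExpSet id F := hint 0 (by simpa using hs₀)
    have hpos : (0 : ℝ) ≤ s' := by exact_mod_cast (hs₀.le.trans h)
    exact convex_integrableExpSet.ordConnected.out h0 hs ⟨hpos, hle⟩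

lemma mgf_mono_of_ae_pos {F : Measure ℝ} (hpos : ∀ᵐ x ∂F, 0 < x) {s s' : ℝ}
    (hs' : s' ∈ integrableExpSet id F) (hs : s ∈ integrableExpSet id F) (hle : s' ≤ s) :
    mgf id F s' ≤ mgf id F s := by
  refine integral_mono_ae hs' hs ?_
  filter_upwards [hpos] with x hx
  exact Real.exp_le_exp.2 (mul_le_mul_of_nonneg_right hle hx.le)

namespace Params
variable {p : Params}

/-- The left side of the equation for `r` is nonpositive at `α₀ = α(r₀)`, since `M_U` increases, and
nonnegative at `1/β`, which bounds every root. So there is a root at or beyond `α₀`. On that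
half-line `-α` stays in the open domain of `M_Y`, the equation is continuous, and the supremum of
the roots is a root. -/
lemma alphaDefined_of_le (hp : p.Admissible) {r r₀ : ℝ} (hr : r ≤ r₀)
    (h₀ : p.AlphaDefined r₀) : p.AlphaDefined r := by
  obtain ⟨hU, hY, hroot⟩ := h₀.1
  set α₀ := p.alpha r₀
  have hUr : r ∈ integrableExpSet id p.FU := hp.FU_steep.mem_of_le hU hr
  have hY' : ∀ α, α₀ ≤ α → -α ∈ integrableExpSet id p.FY := fun α hα =>
    hp.FY_steep.mem_of_le hY (neg_le_neg hα)
  set f : ℝ → ℝ := fun α => α * p.β + mgf id p.FU r * mgf id p.FY (-α) - 1 with hf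
  have hcont : ContinuousOn f (Set.Ici α₀) := by
    intro α hα
    have h1 : ContinuousAt (mgf id p.FY) (-α) :=
      (differentiableAt_mgf (hp.FY_steep.mem_interior hp.FY_pos (hY' α hα))).continuousAt
    have h2 : ContinuousAt (fun α : ℝ => mgf id p.FY (-α)) α :=
      ContinuousAt.comp (f := fun α : ℝ => -α) h1 continuous_neg.continuousAt
    exact (((continuousAt_id.mul continuousAt_const).add
      (continuousAt_const.mul h2)).sub continuousAt_const).continuousWithinAt
  have hbound : ∀ α ∈ p.roots r, α ≤ 1 / p.β := by
    rintro α ⟨-, -, h⟩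
    have : 0 ≤ mgf id p.FU r * mgf id p.FY (-α) := mul_nonneg mgf_nonneg mgf_nonneg
    rw [le_div_iff₀ hp.β_pos]
    linarith
  have hle₀ : f α₀ ≤ 0 := by
    have : mgf id p.FU r * mgf id p.FY (-α₀) ≤ mgf id p.FU r₀ * mgf id p.FY (-α₀) :=
      mul_le_mul_of_nonneg_right (mgf_mono_of_ae_pos hp.FU_pos hUr hU hr) mgf_nonneg
    simp only [hf]; linarith
  have hα₀ : α₀ ≤ 1 / p.β := by
    have : 0 ≤ mgf id p.FU r₀ * mgf id p.FY (-α₀) := mul_nonneg mgf_nonneg mgf_nonneg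
    rw [le_div_iff₀ hp.β_pos]
    linarith
  have hge₁ : 0 ≤ f (1 / p.β) := by
    have : 0 ≤ mgf id p.FU r * mgf id p.FY (-(1 / p.β)) := mul_nonneg mgf_nonneg mgf_nonneg
    have h1 : 1 / p.β * p.β = 1 := by field_simp [hp.β_pos.ne']
    simp only [hf]; linarith
  obtain ⟨α₁, hα₁, hz⟩ := intermediate_value_Icc hα₀ (hcont.mono Set.Icc_subset_Ici_self)
    ⟨hle₀, hge₁⟩
  have hmem₁ : α₁ ∈ p.roots r := ⟨hUr, hY' _ hα₁.1, hz⟩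
  have hbdd : BddAbove (p.roots r) := ⟨_, hbound⟩
  have hge : α₀ ≤ p.alpha r := hα₁.1.trans (le_csSup hbdd hmem₁)
  refine ⟨⟨hUr, hY' _ hge, ?_⟩, fun α hα => le_csSup hbdd hα⟩
  -- Roots below `α₁` do not affect the supremum; discarding them keeps the closure inside the
  -- half-line where `f` is known to be continuous.
  have hcl : p.alpha r ∈ closure (p.roots r ∩ Set.Ici α₁) := by
    have hs : sSup (p.roots r ∩ Set.Ici α₁) = p.alpha r := by
      refine le_antisymm (csSup_le_csSup hbdd ⟨α₁, hmem₁, Set.self_mem_Ici⟩ Set.inter_subset_left) ?_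
      refine csSup_le ⟨α₁, hmem₁⟩ fun α hα => ?_
      have hb : BddAbove (p.roots r ∩ Set.Ici α₁) := hbdd.mono Set.inter_subset_left
      rcases le_total α₁ α with h | h
      · exact le_csSup hb ⟨hα, h⟩
      · exact h.trans (le_csSup hb ⟨hmem₁, Set.self_mem_Ici⟩)
    rw [← hs]
    exact csSup_mem_closure ⟨α₁, hmem₁, Set.self_mem_Ici⟩ (hbdd.mono Set.inter_subset_left)
  have hsub : p.roots r ∩ Set.Ici α₁ ⊆ Set.Ici α₀ ∩ f ⁻¹' {0} := fun α hα =>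
    ⟨hα₁.1.trans hα.2, hα.1.2.2⟩
  have hclosed : IsClosed (Set.Ici α₀ ∩ f ⁻¹' {0}) :=
    hcont.preimage_isClosed_of_isClosed isClosed_Ici isClosed_singleton
  exact (closure_minimal hsub hclosed hcl).2

end Params
end HawkesRisk

/-! ### Deterministic evolution between arrivals -/

namespace HawkesRisk

/-- Arrival times, claims and shocks along one trajectory. -/
abbrev MarkedPath : Type := (ℕ → ℝ) × (ℕ → ℝ) × (ℕ → ℝ)

/-- The intensity at time `t` when exactly the first `k` arrivals are taken into account. -/
noncomputable def intensityAt (p : Params) (k : ℕ) (t : ℝ) (d : MarkedPath) : ℝ :=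
  p.a + (p.lam - p.a) * Real.exp (-p.β * t) +
    ∑ i ∈ Finset.range k, d.2.2 i * Real.exp (-p.β * (t - d.1 i))

/-- The exponential process at time `t` when exactly the first `k` arrivals are taken into
account. -/
noncomputable def expAt (p : Params) (r : ℝ) (k : ℕ) (t : ℝ) (d : MarkedPath) : ℝ :=
  Real.exp (r * p.u + p.alpha r * p.lam) *
    Real.exp (-r * (p.u + p.c * t - ∑ i ∈ Finset.range k, d.2.1 i) -
      p.alpha r * intensityAt p k t d - p.theta r * t)

/-- The factor by which the exponential process is multiplied at an arrival. -/
noncomputable def jumpFactor (p : Params) (r : ℝ) (z : ℝ × ℝ) : ℝ :=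
  Real.exp (r * z.1) * Real.exp (-p.alpha r * z.2)

variable {p : Params} {r : ℝ} {k : ℕ} {d : MarkedPath}

lemma hasDerivAt_intensityAt (t : ℝ) :
    HasDerivAt (fun t => intensityAt p k t d) (-p.β * (intensityAt p k t d - p.a)) t := by
  have h1 : HasDerivAt (fun t : ℝ => Real.exp (-p.β * t)) (Real.exp (-p.β * t) * (-p.β)) t := by
    simpa using ((hasDerivAt_id t).const_mul (-p.β)).exp
  have h2 : ∀ i ∈ Finset.range k, HasDerivAt
      (fun t : ℝ => d.2.2 i * Real.exp (-p.β * (t - d.1 i)))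
      (d.2.2 i * (Real.exp (-p.β * (t - d.1 i)) * (-p.β))) t := fun i _ => by
    simpa using ((((hasDerivAt_id t).sub_const (d.1 i)).const_mul (-p.β)).exp).const_mul (d.2.2 i)
  have h := ((h1.const_mul (p.lam - p.a)).const_add p.a).add (HasDerivAt.fun_sum h2)
  refine h.congr_deriv ?_
  simp only [intensityAt]
  have : ∑ i ∈ Finset.range k, d.2.2 i * (Real.exp (-p.β * (t - d.1 i)) * (-p.β)) =
      -p.β * ∑ i ∈ Finset.range k, d.2.2 i * Real.exp (-p.β * (t - d.1 i)) := by
    rw [Finset.mul_sum]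
    exact Finset.sum_congr rfl fun i _ => by ring
  rw [this]
  ring

/-- The constant contributions `-cr` and `-αβa` are cancelled by `-θ(r)`, leaving a rate
proportional to the intensity. -/
lemma hasDerivAt_expAt (t : ℝ) :
    HasDerivAt (fun t => expAt p r k t d)
      (p.alpha r * p.β * intensityAt p k t d * expAt p r k t d) t := by
  have h1 : HasDerivAt (fun t : ℝ => p.u + p.c * t - ∑ i ∈ Finset.range k, d.2.1 i) p.c t := by
    simpa using (((hasDerivAt_id t).const_mul p.c).const_add p.u).sub_const
      (∑ i ∈ Finset.range k, d.2.1 i)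
  have h2 : HasDerivAt (fun t : ℝ => p.theta r * t) (p.theta r) t := by
    simpa using (hasDerivAt_id t).const_mul (p.theta r)
  have h := (((((h1.const_mul (-r)).sub
    ((hasDerivAt_intensityAt (p := p) (k := k) (d := d) t).const_mul (p.alpha r))).sub h2).exp)).const_mul
      (Real.exp (r * p.u + p.alpha r * p.lam))
  refine h.congr_deriv ?_
  simp only [expAt, Params.theta, Pi.sub_apply]
  ring

lemma continuous_intensityAt : Continuous fun t => intensityAt p k t d :=
  continuous_iff_continuousAt.2 fun t => (hasDerivAt_intensityAt t).continuousAt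

lemma continuous_expAt : Continuous fun t => expAt p r k t d :=
  continuous_iff_continuousAt.2 fun t => (hasDerivAt_expAt t).continuousAt

lemma expAt_nonneg (t : ℝ) : 0 ≤ expAt p r k t d := by unfold expAt; positivity

lemma intensityAt_succ (d : MarkedPath) :
    intensityAt p (k + 1) (d.1 k) d = intensityAt p k (d.1 k) d + d.2.2 k := by
  simp [intensityAt, Finset.sum_range_succ, add_assoc]

lemma expAt_succ (d : MarkedPath) :
    expAt p r (k + 1) (d.1 k) d = expAt p r k (d.1 k) d * jumpFactor p r (d.2.1 k, d.2.2 k) := by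
  unfold expAt jumpFactor
  rw [intensityAt_succ, Finset.sum_range_succ]
  simp only [← Real.exp_add]
  congr 1
  ring

lemma le_intensityAt (hp : p.Admissible) (hd : ∀ i < k, 0 ≤ d.2.2 i) (t : ℝ) :
    p.a ≤ intensityAt p k t d := by
  have h1 : 0 ≤ (p.lam - p.a) * Real.exp (-p.β * t) :=
    mul_nonneg (by linarith [hp.a_lt_lam]) (Real.exp_pos _).le
  have h2 : 0 ≤ ∑ i ∈ Finset.range k, d.2.2 i * Real.exp (-p.β * (t - d.1 i)) :=
    Finset.sum_nonneg fun i hi => mul_nonneg (hd i (Finset.mem_range.1 hi)) (Real.exp_pos _).le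
  unfold intensityAt
  linarith

lemma measurable_intensityAt :
    Measurable fun q : ℝ × MarkedPath => intensityAt p k q.1 q.2 := by
  unfold intensityAt
  fun_prop

lemma measurable_expAt : Measurable fun q : ℝ × MarkedPath => expAt p r k q.1 q.2 := by
  have := measurable_intensityAt (p := p) (k := k)
  unfold expAt
  fun_prop

lemma measurable_jumpFactor : Measurable (jumpFactor p r) := by
  unfold jumpFactor
  fun_prop

lemma intensityAt_congr {d' : MarkedPath} (h1 : ∀ i < k, d.1 i = d'.1 i)
    (h3 : ∀ i < k, d.2.2 i = d'.2.2 i) (t : ℝ) : intensityAt p k t d = intensityAt p k t d' := by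
  unfold intensityAt
  congr 1
  exact Finset.sum_congr rfl fun i hi => by
    rw [h1 i (Finset.mem_range.1 hi), h3 i (Finset.mem_range.1 hi)]

lemma expAt_congr {d' : MarkedPath} (h1 : ∀ i < k, d.1 i = d'.1 i)
    (h2 : ∀ i < k, d.2.1 i = d'.2.1 i) (h3 : ∀ i < k, d.2.2 i = d'.2.2 i) (t : ℝ) :
    expAt p r k t d = expAt p r k t d' := by
  unfold expAt
  rw [intensityAt_congr h1 h3, Finset.sum_congr rfl fun i hi => h2 i (Finset.mem_range.1 hi)]

lemma abs_intensityAt_le (hp : p.Admissible) {m t : ℝ} (ht : 0 ≤ t)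
    (h1 : ∀ i < k, d.1 i ≤ t) (h3 : ∀ i < k, |d.2.2 i| ≤ m) :
    |intensityAt p k t d| ≤ p.lam + k * m := by
  have hβ := hp.β_pos
  have h1' : |p.a + (p.lam - p.a) * Real.exp (-p.β * t)| ≤ p.lam := by
    have ha := hp.a_pos
    have hl : 0 < p.lam - p.a := by linarith [hp.a_lt_lam]
    have he : Real.exp (-p.β * t) ≤ 1 := Real.exp_le_one_iff.2 (by nlinarith)
    rw [abs_of_nonneg (by positivity)]
    nlinarith
  have h2' : |∑ i ∈ Finset.range k, d.2.2 i * Real.exp (-p.β * (t - d.1 i))| ≤ k * m := by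
    refine (Finset.abs_sum_le_sum_abs _ _).trans ?_
    have : ∀ i ∈ Finset.range k, |d.2.2 i * Real.exp (-p.β * (t - d.1 i))| ≤ m := fun i hi => by
      have hi := Finset.mem_range.1 hi
      have he : Real.exp (-p.β * (t - d.1 i)) ≤ 1 :=
        Real.exp_le_one_iff.2 (by nlinarith [h1 i hi])
      rw [abs_mul, Real.abs_exp]
      exact (mul_le_of_le_one_right (abs_nonneg _) he).trans (h3 i hi)
    simpa using Finset.sum_le_sum this
  exact (abs_add_le _ _).trans (add_le_add h1' h2')

/-- Supplies the finiteness that later allows a compensator term to be cancelled, once the marks are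
truncated at `m`. -/
lemma exists_expAt_le (hp : p.Admissible) (r : ℝ) (k : ℕ) (m T : ℝ) :
    ∃ C, ∀ t d, 0 ≤ t → t ≤ T → (∀ i < k, d.1 i ≤ t) → (∀ i < k, |d.2.1 i| ≤ m) →
      (∀ i < k, |d.2.2 i| ≤ m) → expAt p r k t d ≤ C := by
  refine ⟨Real.exp (r * p.u + p.alpha r * p.lam) *
    Real.exp (|r| * (|p.u| + |p.c| * T + k * m) + |p.alpha r| * (p.lam + k * m) +
      |p.theta r| * T), fun t d ht htT h1 h2 h3 => ?_⟩
  unfold expAt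
  refine mul_le_mul_of_nonneg_left (Real.exp_le_exp.2 ?_) (Real.exp_pos _).le
  have hs : |∑ i ∈ Finset.range k, d.2.1 i| ≤ k * m :=
    (Finset.abs_sum_le_sum_abs _ _).trans <| by
      simpa using Finset.sum_le_sum (fun i hi => h2 i (Finset.mem_range.1 hi))
  have hx : |p.u + p.c * t - ∑ i ∈ Finset.range k, d.2.1 i| ≤ |p.u| + |p.c| * T + k * m := by
    refine (abs_sub _ _).trans (add_le_add ((abs_add_le _ _).trans (add_le_add le_rfl ?_)) hs)
    rw [abs_mul, abs_of_nonneg ht]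
    exact mul_le_mul_of_nonneg_left htT (abs_nonneg _)
  have e1 : -r * (p.u + p.c * t - ∑ i ∈ Finset.range k, d.2.1 i) ≤
      |r| * (|p.u| + |p.c| * T + k * m) :=
    (le_abs_self _).trans <| by
      rw [abs_mul, abs_neg]; exact mul_le_mul_of_nonneg_left hx (abs_nonneg _)
  have e2 : -(p.alpha r * intensityAt p k t d) ≤ |p.alpha r| * (p.lam + k * m) :=
    (neg_le_abs _).trans <| by
      rw [abs_mul]
      exact mul_le_mul_of_nonneg_left (abs_intensityAt_le hp ht h1 h3) (abs_nonneg _)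
  have e3 : -(p.theta r * t) ≤ |p.theta r| * T :=
    (neg_le_abs _).trans <| by
      rw [abs_mul, abs_of_nonneg ht]; exact mul_le_mul_of_nonneg_left htT (abs_nonneg _)
  linarith

/-- A one-sided fundamental theorem of calculus for nonnegative functions. -/
lemma ofReal_add_lintegral_le {f f' g h : ℝ → ℝ} {l v : ℝ} (hlv : l ≤ v)
    (hf : ∀ x, HasDerivAt f (f' x) x) (hf' : Continuous f') (hg : Continuous g)
    (hh : Continuous h) (hf0 : ∀ x ∈ Set.Icc l v, 0 ≤ f x) (hg0 : ∀ x ∈ Set.Icc l v, 0 ≤ g x)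
    (hh0 : ∀ x ∈ Set.Icc l v, 0 ≤ h x) (hle : ∀ x ∈ Set.Icc l v, f' x + g x ≤ h x) :
    ENNReal.ofReal (f v) + ∫⁻ x in Set.Ioc l v, ENNReal.ofReal (g x) ≤
      ENNReal.ofReal (f l) + ∫⁻ x in Set.Ioc l v, ENNReal.ofReal (h x) := by
  have key : ∀ φ : ℝ → ℝ, Continuous φ → (∀ x ∈ Set.Icc l v, 0 ≤ φ x) →
      ∫⁻ x in Set.Ioc l v, ENNReal.ofReal (φ x) = ENNReal.ofReal (∫ x in l..v, φ x) :=
    fun φ hφ hφ0 => by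
      rw [intervalIntegral.integral_of_le hlv, ofReal_integral_eq_lintegral_ofReal]
      · exact (hφ.integrableOn_Icc).mono_set Set.Ioc_subset_Icc_self
      · exact (ae_restrict_mem measurableSet_Ioc).mono fun x hx =>
          hφ0 x (Set.Ioc_subset_Icc_self hx)
  have hft : ∫ x in l..v, f' x = f v - f l :=
    intervalIntegral.integral_eq_sub_of_hasDerivAt (fun x _ => hf x)
      (hf'.intervalIntegrable _ _)
  have hmono : ∫ x in l..v, (f' x + g x) ≤ ∫ x in l..v, h x :=
    intervalIntegral.integral_mono_on hlv ((hf'.add hg).intervalIntegrable _ _)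
      (hh.intervalIntegrable _ _) hle
  rw [intervalIntegral.integral_add (hf'.intervalIntegrable _ _) (hg.intervalIntegrable _ _),
    hft] at hmono
  rw [key g hg hg0, key h hh hh0,
    ← ENNReal.ofReal_add (hf0 v ⟨hlv, le_rfl⟩) (intervalIntegral.integral_nonneg hlv hg0),
    ← ENNReal.ofReal_add (hf0 l ⟨le_rfl, hlv⟩) (intervalIntegral.integral_nonneg hlv hh0)]
  exact ENNReal.ofReal_le_ofReal (by linarith)

/-- The reverse one-sided fundamental theorem of calculus for nonnegative functions. -/
lemma le_ofReal_add_lintegral {f f' g h : ℝ → ℝ} {l v : ℝ} (hlv : l ≤ v)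
    (hf : ∀ x, HasDerivAt f (f' x) x) (hf' : Continuous f') (hg : Continuous g)
    (hh : Continuous h) (hf0 : ∀ x ∈ Set.Icc l v, 0 ≤ f x) (hg0 : ∀ x ∈ Set.Icc l v, 0 ≤ g x)
    (hh0 : ∀ x ∈ Set.Icc l v, 0 ≤ h x) (hle : ∀ x ∈ Set.Icc l v, h x ≤ f' x + g x) :
    ENNReal.ofReal (f l) + ∫⁻ x in Set.Ioc l v, ENNReal.ofReal (h x) ≤
      ENNReal.ofReal (f v) + ∫⁻ x in Set.Ioc l v, ENNReal.ofReal (g x) := by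
  have hrefl : ∀ x, l + v - x ∈ Set.Icc l v ↔ x ∈ Set.Icc l v := fun x => by
    constructor <;> rintro ⟨h1, h2⟩ <;> constructor <;> linarith
  have hd : ∀ x, HasDerivAt (fun x => f (l + v - x)) (-f' (l + v - x)) x := fun x => by
    have h := (hf (l + v - x)).comp x ((hasDerivAt_id x).const_sub (l + v))
    rw [mul_neg_one] at h
    exact h
  have hc : Continuous fun x : ℝ => l + v - x := by fun_prop
  have hint : ∀ φ : ℝ → ℝ, ∫⁻ x in Set.Ioc l v, ENNReal.ofReal (φ (l + v - x)) =
      ∫⁻ x in Set.Ioc l v, ENNReal.ofReal (φ x) := fun φ => by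
    -- Reflection turns `(l, v]` into `[l, v)`; open intervals are preserved.
    rw [setLIntegral_congr Ioo_ae_eq_Ioc.symm, setLIntegral_congr Ioo_ae_eq_Ioc.symm]
    have := (Measure.measurePreserving_sub_left (volume : Measure ℝ) (l + v)).setLIntegral_comp_preimage_emb
      (Homeomorph.subLeft (l + v)).measurableEmbedding (fun x => ENNReal.ofReal (φ x)) (Set.Ioo l v)
    simpa using this
  -- Time reversal changes the sign of `f'`, so `g` and `h` exchange roles.
  have := ofReal_add_lintegral_le hlv hd (hf'.comp hc).neg (hh.comp hc) (hg.comp hc)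
    (fun x hx => hf0 _ ((hrefl x).2 hx)) (fun x hx => hh0 _ ((hrefl x).2 hx))
    (fun x hx => hg0 _ ((hrefl x).2 hx)) (fun x hx => by
      have := hle _ ((hrefl x).2 hx)
      simp only [Function.comp_apply]
      linarith)
  simp only [Function.comp_apply] at this
  rw [hint, hint] at this
  simpa using this

end HawkesRisk

/-! ### Trajectories and predictability -/

namespace HawkesRisk

lemma measurable_markedPath {α : Type*} [MeasurableSpace α] {f g h : ℕ → α → ℝ}
    (hf : ∀ i, Measurable (f i)) (hg : ∀ i, Measurable (g i)) (hh : ∀ i, Measurable (h i)) :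
    Measurable fun a => ((fun i => f i a, fun i => g i a, fun i => h i a) : MarkedPath) :=
  (measurable_pi_iff.2 hf).prodMk ((measurable_pi_iff.2 hg).prodMk (measurable_pi_iff.2 hh))

section Trajectories

variable {Ω : Type*} {T : ℕ → Ω → ℝ≥0} {U Y : ℕ → Ω → ℝ} {p : Params}

/-- The trajectory of arrivals, claims and shocks. -/
def path (T : ℕ → Ω → ℝ≥0) (U Y : ℕ → Ω → ℝ) (ω : Ω) : MarkedPath :=
  (fun i => (T i ω : ℝ), fun i => U i ω, fun i => Y i ω)

/-- The trajectory strictly before a given time; later entries are set to `0`. -/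
noncomputable def leftPath (T : ℕ → Ω → ℝ≥0) (U Y : ℕ → Ω → ℝ) (q : ℝ≥0 × Ω) : MarkedPath :=
  (fun i => if T i q.2 < q.1 then (T i q.2 : ℝ) else 0,
    fun i => if T i q.2 < q.1 then U i q.2 else 0,
    fun i => if T i q.2 < q.1 then Y i q.2 else 0)

/-- The arrival preceding the `k`-th one, or `0`. -/
def prevArrival (T : ℕ → Ω → ℝ≥0) (k : ℕ) (ω : Ω) : ℝ≥0 :=
  match k with
  | 0 => 0
  | k + 1 => T k ω

/-- A trajectory is regular if the arrivals are positive, strictly increasing to infinity and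
all marks are positive. -/
structure Regular (T : ℕ → Ω → ℝ≥0) (U Y : ℕ → Ω → ℝ) (ω : Ω) : Prop where
  first_pos : 0 < T 0 ω
  strictMono : StrictMono fun n => T n ω
  tendsto : Tendsto (fun n => T n ω) atTop atTop
  claim_pos : ∀ n, 0 < U n ω
  shock_pos : ∀ n, 0 < Y n ω

/-- The first `k` marks are bounded by `m`. -/
def boundedMarks (U Y : ℕ → Ω → ℝ) (k m : ℕ) : Set Ω :=
  {ω | ∀ i < k, |U i ω| ≤ m ∧ |Y i ω| ≤ m}

/-- The stochastic interval between the arrivals `k - 1` and `k`, restricted to times in `(s, t]`,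
to the event `A` and to trajectories whose previous marks are bounded by `m`. -/
def strip (T : ℕ → Ω → ℝ≥0) (U Y : ℕ → Ω → ℝ) (A : Set Ω) (s t : ℝ≥0) (k m : ℕ) :
    Set (ℝ≥0 × Ω) :=
  {q | (s < q.1 ∧ q.2 ∈ A) ∧ q.1 ≤ t ∧ q.1 ≤ T k q.2 ∧
    ∀ i < k, T i q.2 < q.1 ∧ |U i q.2| ≤ m ∧ |Y i q.2| ≤ m}

lemma Regular.prevArrival_lt {ω : Ω} (h : Regular T U Y ω) (k : ℕ) :
    prevArrival T k ω < T k ω := by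
  cases k with
  | zero => exact h.first_pos
  | succ k => exact h.strictMono k.lt_succ_self

lemma Regular.le_prevArrival {ω : Ω} (h : Regular T U Y ω) {i k : ℕ} (hik : i < k) :
    T i ω ≤ prevArrival T k ω := by
  cases k with
  | zero => omega
  | succ k => exact h.strictMono.monotone (Nat.lt_succ_iff.1 hik)

lemma Regular.count_eq {ω : Ω} (h : Regular T U Y ω) {k : ℕ} {t : ℝ≥0}
    (h1 : prevArrival T k ω ≤ t) (h2 : t < T k ω) : count T t ω = k := by
  have : {n | T n ω ≤ t} = (Finset.range k : Set ℕ) := by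
    ext n
    simp only [Set.mem_ofPred_eq, Finset.coe_range, Set.mem_Iio]
    refine ⟨fun hn => ?_, fun hn => (h.le_prevArrival hn).trans h1⟩
    exact h.strictMono.lt_iff_lt.1 (hn.trans_lt h2)
  rw [count, this, Set.ncard_coe_finset, Finset.card_range]

lemma Regular.exists_count {ω : Ω} (h : Regular T U Y ω) (t : ℝ≥0) :
    ∃ k, prevArrival T k ω ≤ t ∧ t < T k ω := by
  classical
  have hex : ∃ k, t < T k ω := (h.tendsto.eventually_gt_atTop t).exists
  refine ⟨Nat.find hex, ?_, Nat.find_spec hex⟩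
  rcases hk : Nat.find hex with _ | k
  · exact zero_le
  · exact not_lt.1 (Nat.find_min hex (hk ▸ k.lt_succ_self))

lemma intensity_eq (t : ℝ≥0) (ω : Ω) :
    intensity p T Y t ω = intensityAt p (count T t ω) t (path T U Y ω) := rfl

lemma expMart_eq (r : ℝ) (t : ℝ≥0) (ω : Ω) :
    expMart p T U Y r t ω = expAt p r (count T t ω) t (path T U Y ω) := rfl

end Trajectories

variable {Ω : Type*} {mΩ : MeasurableSpace Ω} {P : Measure Ω} {ℱ : Filtration ℝ≥0 mΩ}
  {p : Params} {T : ℕ → Ω → ℝ≥0} {U Y : ℕ → Ω → ℝ}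

namespace IsHawkesModel

lemma measurable_arrival (hm : IsHawkesModel p P ℱ T U Y) (n : ℕ) : Measurable (T n) := by
  refine measurable_of_Iic fun c => ?_
  have h : T n ⁻¹' Set.Iic c = {ω | (T n ω : WithTop ℝ≥0) ≤ c} := by
      ext x; exact (WithTop.coe_le_coe (a := c) (b := T n x)).symm
  rw [h]
  exact ℱ.le c _ (hm.stopping n c)

lemma measurable_claim (hm : IsHawkesModel p P ℱ T U Y) (n : ℕ) : Measurable (U n) :=
  (hm.claim_meas n).mono (hm.stopping n).measurableSpace_le le_rfl

lemma measurable_shock (hm : IsHawkesModel p P ℱ T U Y) (n : ℕ) : Measurable (Y n) :=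
  (hm.shock_meas n).mono (hm.stopping n).measurableSpace_le le_rfl

lemma measurable_path (hm : IsHawkesModel p P ℱ T U Y) : Measurable (path T U Y) := by
  refine measurable_markedPath (fun i => ?_) (fun i => ?_) fun i => ?_
  · exact (hm.measurable_arrival i).coe_nnreal_real
  · exact hm.measurable_claim i
  · exact hm.measurable_shock i

lemma measurable_prevArrival (hm : IsHawkesModel p P ℱ T U Y) (k : ℕ) :
    Measurable (prevArrival T k) := by
  cases k with
  | zero => exact measurable_const
  | succ k => exact hm.measurable_arrival k

lemma ae_regular (hm : IsHawkesModel p P ℱ T U Y) (hp : p.Admissible) :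
    ∀ᵐ ω ∂P, Regular T U Y ω := by
  have hU : ∀ᵐ ω ∂P, ∀ n, 0 < U n ω := ae_all_iff.2 fun n =>
    ae_of_ae_map (hm.measurable_claim n).aemeasurable
      (p := fun x => 0 < x) (by rw [hm.claim_law]; exact hp.FU_pos)
  have hY : ∀ᵐ ω ∂P, ∀ n, 0 < Y n ω := ae_all_iff.2 fun n =>
    ae_of_ae_map (hm.measurable_shock n).aemeasurable
      (p := fun x => 0 < x) (by rw [hm.shock_law]; exact hp.FY_pos)
  filter_upwards [hm.first_pos, hm.strictMono, hm.tendsto, hU, hY] with ω h1 h2 h3 h4 h5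
  exact ⟨h1, h2, h3, h4, h5⟩

/-- Information available at an arrival is predictable strictly after this arrival. -/
lemma measurableSet_predictable_after (hm : IsHawkesModel p P ℱ T U Y) (n : ℕ) {B : Set Ω}
    (hB : MeasurableSet[(hm.stopping n).measurableSpace] B) :
    MeasurableSet[ℱ.predictable] {q : ℝ≥0 × Ω | T n q.2 < q.1 ∧ q.2 ∈ B} := by
  -- A rational time between the arrival and `q.1` exhibits the set as a countable union of
  -- predictable rectangles `(c, ∞) × ℱ c`.
  have : {q : ℝ≥0 × Ω | T n q.2 < q.1 ∧ q.2 ∈ B} =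
      ⋃ c : ℚ, Set.Ioi (Real.toNNReal c) ×ˢ
        (B ∩ {ω | (T n ω : WithTop ℝ≥0) ≤ (Real.toNNReal c : ℝ≥0)}) := by
    ext ⟨u, ω⟩
    simp only [Set.mem_ofPred_eq, Set.mem_iUnion, Set.mem_prod, Set.mem_Ioi, Set.mem_inter_iff,
      WithTop.coe_le_coe]
    constructor
    · rintro ⟨h1, h2⟩
      obtain ⟨c, -, hc1, hc2⟩ := (NNReal.lt_iff_exists_rat_btwn _ _).1 h1
      exact ⟨c, hc2, h2, hc1.le⟩
    · rintro ⟨c, h1, h2, h3⟩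
      exact ⟨h3.trans_lt h1, h2⟩
  rw [this]
  exact MeasurableSet.iUnion fun c => measurableSet_predictable_Ioi_prod (hB.2 _)

lemma measurableSet_predictable_arrival_lt (hm : IsHawkesModel p P ℱ T U Y) (n : ℕ) :
    MeasurableSet[ℱ.predictable] {q : ℝ≥0 × Ω | T n q.2 < q.1} := by
  simpa using hm.measurableSet_predictable_after n (B := Set.univ)
    (@MeasurableSet.univ _ (hm.stopping n).measurableSpace)

lemma measurable_predictable_after (hm : IsHawkesModel p P ℱ T U Y) (n : ℕ) {f : Ω → ℝ}
    (hf : Measurable[(hm.stopping n).measurableSpace] f) :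
    Measurable[ℱ.predictable] fun q : ℝ≥0 × Ω => if T n q.2 < q.1 then f q.2 else 0 := by
  intro B hB
  have h1 := hm.measurableSet_predictable_after n (hf hB)
  have h2 := hm.measurableSet_predictable_arrival_lt n
  by_cases h0 : (0 : ℝ) ∈ B
  · have : (fun q : ℝ≥0 × Ω => if T n q.2 < q.1 then f q.2 else 0) ⁻¹' B =
        {q : ℝ≥0 × Ω | T n q.2 < q.1 ∧ q.2 ∈ f ⁻¹' B} ∪ {q : ℝ≥0 × Ω | T n q.2 < q.1}ᶜ := by
      ext q
      by_cases hq : T n q.2 < q.1 <;> simp [hq, h0]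
    rw [this]
    exact @MeasurableSet.union _ ℱ.predictable _ _ h1 h2.compl
  · have : (fun q : ℝ≥0 × Ω => if T n q.2 < q.1 then f q.2 else 0) ⁻¹' B =
        {q : ℝ≥0 × Ω | T n q.2 < q.1 ∧ q.2 ∈ f ⁻¹' B} := by
      ext q
      by_cases hq : T n q.2 < q.1 <;> simp [hq, h0]
    rw [this]
    exact h1

lemma measurable_arrival_stopping (hm : IsHawkesModel p P ℱ T U Y) (n : ℕ) :
    Measurable[(hm.stopping n).measurableSpace] fun ω => (T n ω : ℝ) := by
  have h : Measurable[(hm.stopping n).measurableSpace] (T n) := by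
    refine @measurable_of_Iic _ _ _ _ _ (hm.stopping n).measurableSpace _ _ _ _ fun c => ?_
    have h : T n ⁻¹' Set.Iic c = {ω | (T n ω : WithTop ℝ≥0) ≤ c} := by
      ext x; exact (WithTop.coe_le_coe (a := c) (b := T n x)).symm
    rw [h]
    exact (hm.stopping n).measurable measurableSet_Iic
  exact measurable_coe_nnreal_real.comp h

/-- The compensator formula accepts only predictable integrands, and `path` looks into the future;
`leftPath` is its predictable substitute. -/
lemma measurable_leftPath (hm : IsHawkesModel p P ℱ T U Y) :
    Measurable[ℱ.predictable] (leftPath T U Y) := by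
  refine @measurable_markedPath _ ℱ.predictable _ _ _ (fun i => ?_) (fun i => ?_) fun i => ?_
  · exact hm.measurable_predictable_after i (hm.measurable_arrival_stopping i)
  · exact hm.measurable_predictable_after i (hm.claim_meas i)
  · exact hm.measurable_predictable_after i (hm.shock_meas i)

end IsHawkesModel

lemma measurable_predictable_time :
    Measurable[ℱ.predictable] fun q : ℝ≥0 × Ω => q.1 := by
  refine @measurable_of_Ioi _ _ _ _ _ ℱ.predictable _ _ _ _ fun c => ?_
  have h := measurableSet_predictable_Ioi_prod (𝓕 := ℱ) (i := c) (s := Set.univ)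
    (@MeasurableSet.univ _ (ℱ c))
  have he : (fun q : ℝ≥0 × Ω => q.1) ⁻¹' Set.Ioi c = Set.Ioi c ×ˢ Set.univ := by ext; simp
  rw [he]
  exact h

lemma IsHawkesModel.measurableSet_strip (hm : IsHawkesModel p P ℱ T U Y) {A : Set Ω} {s : ℝ≥0}
    (hA : MeasurableSet[ℱ s] A) (t : ℝ≥0) (k m : ℕ) :
    MeasurableSet[ℱ.predictable] (strip T U Y A s t k m) := by
  have h1 : MeasurableSet[ℱ.predictable] {q : ℝ≥0 × Ω | s < q.1 ∧ q.2 ∈ A} :=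
    measurableSet_predictable_Ioi_prod hA
  have h2 : MeasurableSet[ℱ.predictable] {q : ℝ≥0 × Ω | q.1 ≤ t} :=
    measurable_predictable_time measurableSet_Iic
  have h3 : MeasurableSet[ℱ.predictable] {q : ℝ≥0 × Ω | q.1 ≤ T k q.2} := by
    have := (hm.measurableSet_predictable_arrival_lt k).compl
    simpa [Set.compl_ofPred] using this
  have h4 : MeasurableSet[ℱ.predictable]
      {q : ℝ≥0 × Ω | ∀ i < k, T i q.2 < q.1 ∧ |U i q.2| ≤ m ∧ |Y i q.2| ≤ m} := by
    have hb : MeasurableSet {x : ℝ | |x| ≤ m} := measurableSet_le measurable_id.abs measurable_const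
    have he : {q : ℝ≥0 × Ω | ∀ i < k, T i q.2 < q.1 ∧ |U i q.2| ≤ m ∧ |Y i q.2| ≤ m} =
        ⋂ i ∈ Finset.range k, {q : ℝ≥0 × Ω | T i q.2 < q.1 ∧
          q.2 ∈ (U i ⁻¹' {x : ℝ | |x| ≤ m} ∩ Y i ⁻¹' {x : ℝ | |x| ≤ m})} := by
      ext q
      simp
    rw [he]
    refine @Finset.measurableSet_biInter _ _ ℱ.predictable _ _ fun i _ => ?_
    exact hm.measurableSet_predictable_after i
      (@MeasurableSet.inter _ (hm.stopping i).measurableSpace _ _ (hm.claim_meas i hb)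
        (hm.shock_meas i hb))
  exact @MeasurableSet.inter _ ℱ.predictable _ _ h1
    (@MeasurableSet.inter _ ℱ.predictable _ _ h2 (@MeasurableSet.inter _ ℱ.predictable _ _ h3 h4))

end HawkesRisk

/-! ### The compensator formula on one stage -/

namespace HawkesRisk

section Trajectories

variable {Ω : Type*} {T : ℕ → Ω → ℝ≥0} {U Y : ℕ → Ω → ℝ} {p : Params}

/-- A function of time, trajectory and mark only depends on the first `k` entries of the
trajectory. -/
def DependsOnFirst (k : ℕ) (G : (ℝ × MarkedPath) × (ℝ × ℝ) → ℝ≥0∞) : Prop :=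
  ∀ u z (d d' : MarkedPath), (∀ i < k, d.1 i = d'.1 i) → (∀ i < k, d.2.1 i = d'.2.1 i) →
    (∀ i < k, d.2.2 i = d'.2.2 i) → G ((u, d), z) = G ((u, d'), z)

lemma DependsOnFirst.leftPath {k : ℕ} {G : (ℝ × MarkedPath) × (ℝ × ℝ) → ℝ≥0∞}
    (hG : DependsOnFirst k G) {q : ℝ≥0 × Ω} (hq : ∀ i < k, T i q.2 < q.1) (u : ℝ) (z : ℝ × ℝ) :
    G ((u, leftPath T U Y q), z) = G ((u, path T U Y q.2), z) := by
  apply hG <;> intro i hi <;> simp [HawkesRisk.leftPath, path, hq i hi]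

/-- The strip contains its right endpoint and not its left one, so only the `k`-th arrival can fall
in it; the sum over arrivals collapses to one term. -/
lemma Regular.mem_strip_arrival {ω : Ω} (h : Regular T U Y ω) {A : Set Ω} {s t : ℝ≥0} {k m n : ℕ} :
    (T n ω, ω) ∈ strip T U Y A s t k m ↔
      n = k ∧ ω ∈ A ∩ boundedMarks U Y k m ∧ T k ω ∈ Set.Ioc s t := by
  simp only [strip, boundedMarks, Set.mem_ofPred_eq, Set.mem_inter_iff, Set.mem_Ioc]
  constructor
  · rintro ⟨⟨h1, h2⟩, h3, h4, h5⟩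
    have hnk : n ≤ k := h.strictMono.le_iff_le.1 h4
    have hkn : k ≤ n := by
      by_contra! hlt
      exact lt_irrefl _ (h5 n hlt).1
    obtain rfl := le_antisymm hnk hkn
    exact ⟨rfl, ⟨h2, fun i hi => (h5 i hi).2⟩, h1, h3⟩
  · rintro ⟨rfl, ⟨h2, h5⟩, h1, h3⟩
    exact ⟨⟨h1, h2⟩, h3, le_rfl, fun i hi => ⟨h.strictMono hi, h5 i hi⟩⟩

lemma Regular.mem_strip {ω : Ω} (h : Regular T U Y ω) {A : Set Ω} {s t u : ℝ≥0} {k m : ℕ} :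
    (u, ω) ∈ strip T U Y A s t k m ↔
      ω ∈ A ∩ boundedMarks U Y k m ∧
        u ∈ Set.Ioc (max (prevArrival T k ω) s) (min (T k ω) t) := by
  simp only [strip, boundedMarks, Set.mem_ofPred_eq, Set.mem_inter_iff, Set.mem_Ioc, max_lt_iff,
    le_min_iff]
  constructor
  · rintro ⟨⟨h1, h2⟩, h3, h4, h5⟩
    refine ⟨⟨h2, fun i hi => (h5 i hi).2⟩, ⟨?_, h1⟩, h4, h3⟩
    cases k with
    | zero => exact zero_le.trans_lt h1
    | succ k => exact (h5 k k.lt_succ_self).1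
  · rintro ⟨⟨h2, h5⟩, ⟨h0, h1⟩, h4, h3⟩
    exact ⟨⟨h1, h2⟩, h3, h4, fun i hi => ⟨(h.le_prevArrival hi).trans_lt h0, h5 i hi⟩⟩

end Trajectories

variable {Ω : Type*} {mΩ : MeasurableSpace Ω} {P : Measure Ω} {ℱ : Filtration ℝ≥0 mΩ}
  {p : Params} {T : ℕ → Ω → ℝ≥0} {U Y : ℕ → Ω → ℝ}

lemma IsHawkesModel.measurableSet_boundedMarks (hm : IsHawkesModel p P ℱ T U Y) (k m : ℕ) :
    MeasurableSet (boundedMarks U Y k m) := by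
  have he : boundedMarks U Y k m = ⋂ i ∈ Finset.range k, {ω | |U i ω| ≤ m ∧ |Y i ω| ≤ m} := by
    ext ω; simp [boundedMarks]
  rw [he]
  refine Finset.measurableSet_biInter _ fun i _ => ?_
  exact (measurableSet_le (hm.measurable_claim i).abs measurable_const).inter
    (measurableSet_le (hm.measurable_shock i).abs measurable_const)

/-- The compensator formula on the stochastic interval between two arrivals. -/
lemma IsHawkesModel.lintegral_arrival (hm : IsHawkesModel p P ℱ T U Y) (hp : p.Admissible)
    {A : Set Ω} {s : ℝ≥0} (hA : MeasurableSet[ℱ s] A) (t : ℝ≥0) (k m : ℕ)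
    {G : (ℝ × MarkedPath) × (ℝ × ℝ) → ℝ≥0∞} (hG : Measurable G) (hGk : DependsOnFirst k G) :
    ∫⁻ ω in A ∩ boundedMarks U Y k m,
        (T k ⁻¹' Set.Ioc s t).indicator
          (fun ω => G (((T k ω : ℝ), path T U Y ω), (U k ω, Y k ω))) ω ∂P =
      ∫⁻ ω in A ∩ boundedMarks U Y k m,
        (∫⁻ u in Set.Ioc (max (prevArrival T k ω : ℝ) s) (min (T k ω : ℝ) t),
          ENNReal.ofReal (intensityAt p k u (path T U Y ω)) *
            ∫⁻ x, ∫⁻ y, G ((u, path T U Y ω), (x, y)) ∂p.FY ∂p.FU) ∂P := by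
  have hAm : MeasurableSet (A ∩ boundedMarks U Y k m) :=
    (ℱ.le s _ hA).inter (hm.measurableSet_boundedMarks k m)
  set S := strip T U Y A s t k m with hS
  -- On the strip the first `k` entries of `leftPath` are the true ones, and `G` sees no others.
  let H : (ℝ≥0 × Ω) × (ℝ × ℝ) → ℝ≥0∞ := fun z =>
    (Prod.fst ⁻¹' S).indicator (fun z => G (((z.1.1 : ℝ), leftPath T U Y z.1), z.2)) z
  have hH : @Measurable _ _ (ℱ.predictable.prod inferInstance) _ H := by
    have hf : @Measurable ((ℝ≥0 × Ω) × (ℝ × ℝ)) (ℝ≥0 × Ω)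
        (ℱ.predictable.prod inferInstance) ℱ.predictable Prod.fst :=
      @measurable_fst _ _ ℱ.predictable _
    have hs : @Measurable ((ℝ≥0 × Ω) × (ℝ × ℝ)) (ℝ × ℝ)
        (ℱ.predictable.prod inferInstance) _ Prod.snd :=
      @measurable_snd _ _ ℱ.predictable _
    have hSm : @MeasurableSet ((ℝ≥0 × Ω) × (ℝ × ℝ)) (ℱ.predictable.prod inferInstance)
        (Prod.fst ⁻¹' S) := hf (hm.measurableSet_strip hA t k m)
    have h1 : @Measurable ((ℝ≥0 × Ω) × (ℝ × ℝ)) ℝ (ℱ.predictable.prod inferInstance) _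
        fun z => (z.1.1 : ℝ) :=
      measurable_coe_nnreal_real.comp (measurable_predictable_time.comp hf)
    have h2 : @Measurable ((ℝ≥0 × Ω) × (ℝ × ℝ)) MarkedPath (ℱ.predictable.prod inferInstance) _
        fun z => leftPath T U Y z.1 := hm.measurable_leftPath.comp hf
    exact @Measurable.indicator _ _ _ _ (ℱ.predictable.prod inferInstance) _ _
      (hG.comp ((h1.prodMk h2).prodMk hs)) hSm
  have key := hm.compensator H hH
  have hl : ∫⁻ ω, ∑' n, H ((T n ω, ω), (U n ω, Y n ω)) ∂P =
      ∫⁻ ω in A ∩ boundedMarks U Y k m,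
        (T k ⁻¹' Set.Ioc s t).indicator
          (fun ω => G (((T k ω : ℝ), path T U Y ω), (U k ω, Y k ω))) ω ∂P := by
    rw [← lintegral_indicator hAm]
    refine lintegral_congr_ae ?_
    filter_upwards [hm.ae_regular hp] with ω hω
    rw [tsum_eq_single k]
    · by_cases h : ω ∈ A ∩ boundedMarks U Y k m ∧ T k ω ∈ Set.Ioc s t
      · have hin : (T k ω, ω) ∈ S := hω.mem_strip_arrival.2 ⟨rfl, h⟩
        have hz : ((T k ω, ω), (U k ω, Y k ω)) ∈
            (Prod.fst ⁻¹' S : Set ((ℝ≥0 × Ω) × (ℝ × ℝ))) := hin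
        simp only [H]
        rw [Set.indicator_of_mem hz, Set.indicator_of_mem h.1,
          Set.indicator_of_mem (s := T k ⁻¹' Set.Ioc s t) h.2]
        exact hGk.leftPath (fun i hi => hω.strictMono hi) _ _
      · have hin : (T k ω, ω) ∉ S := fun h' => h (hω.mem_strip_arrival.1 h').2
        have hz : ((T k ω, ω), (U k ω, Y k ω)) ∉
            (Prod.fst ⁻¹' S : Set ((ℝ≥0 × Ω) × (ℝ × ℝ))) := hin
        simp only [H]
        rw [Set.indicator_of_notMem hz]
        by_cases h1 : ω ∈ A ∩ boundedMarks U Y k m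
        · rw [Set.indicator_of_mem h1,
            Set.indicator_of_notMem (s := T k ⁻¹' Set.Ioc s t) (fun h2 => h ⟨h1, h2⟩)]
        · rw [Set.indicator_of_notMem h1]
    · intro n hn
      refine Set.indicator_of_notMem ?_ _
      simp [hS, hω.mem_strip_arrival, hn]
  have hr : ∫⁻ ω, (∫⁻ t in Set.Ici (0 : ℝ), ENNReal.ofReal (intensity p T Y t.toNNReal ω) *
        (∫⁻ x, (∫⁻ y, H ((t.toNNReal, ω), (x, y)) ∂p.FY) ∂p.FU)) ∂P =
      ∫⁻ ω in A ∩ boundedMarks U Y k m,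
        (∫⁻ u in Set.Ioc (max (prevArrival T k ω : ℝ) s) (min (T k ω : ℝ) t),
          ENNReal.ofReal (intensityAt p k u (path T U Y ω)) *
            ∫⁻ x, ∫⁻ y, G ((u, path T U Y ω), (x, y)) ∂p.FY ∂p.FU) ∂P := by
    rw [← lintegral_indicator hAm]
    refine lintegral_congr_ae ?_
    filter_upwards [hm.ae_regular hp] with ω hω
    by_cases h1 : ω ∈ A ∩ boundedMarks U Y k m
    · rw [Set.indicator_of_mem h1, ← lintegral_indicator measurableSet_Ioc,
        ← lintegral_indicator measurableSet_Ici]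
      -- At the arrival itself the count has already moved to `k + 1`; that single time is null.
      have hne : ∀ᵐ u : ℝ, u ≠ T k ω := 
        compl_mem_ae_iff.2 (measure_singleton _)
      refine lintegral_congr_ae ?_
      filter_upwards [hne] with u hu
      by_cases hu0 : 0 ≤ u
      · lift u to ℝ≥0 using hu0
        have hmem : (u : ℝ) ∈ Set.Ioc (max (prevArrival T k ω : ℝ) s) (min (T k ω : ℝ) t) ↔
            u ∈ Set.Ioc (max (prevArrival T k ω) s) (min (T k ω) t) := by
          simp only [Set.mem_Ioc, max_lt_iff, le_min_iff, NNReal.coe_lt_coe, NNReal.coe_le_coe]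
        rw [Set.indicator_of_mem (by simp : (u : ℝ) ∈ Set.Ici (0 : ℝ)), Real.toNNReal_coe]
        by_cases h2 : u ∈ Set.Ioc (max (prevArrival T k ω) s) (min (T k ω) t)
        · rw [Set.indicator_of_mem (hmem.2 h2)]
          have hlt : u < T k ω :=
            lt_of_le_of_ne (h2.2.trans (min_le_left _ _)) (by exact_mod_cast hu)
          have hge : prevArrival T k ω < u := (le_max_left _ _).trans_lt h2.1
          rw [intensity_eq (U := U), hω.count_eq hge.le hlt]
          congr 1
          have hin : (u, ω) ∈ S := hω.mem_strip.2 ⟨h1, h2⟩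
          refine lintegral_congr fun x => lintegral_congr fun y => ?_
          have hz : ((u, ω), (x, y)) ∈ (Prod.fst ⁻¹' S : Set ((ℝ≥0 × Ω) × (ℝ × ℝ))) := hin
          simp only [H]
          rw [Set.indicator_of_mem hz]
          exact hGk.leftPath (fun i hi => (hω.le_prevArrival hi).trans_lt hge) _ _
        · rw [Set.indicator_of_notMem (fun h => h2 (hmem.1 h))]
          have hin : (u, ω) ∉ S := fun h => h2 (hω.mem_strip.1 h).2
          have hz : ∀ x y, H ((u, ω), (x, y)) = 0 := fun x y =>
            Set.indicator_of_notMem (s := Prod.fst ⁻¹' S) hin _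
          simp [hz]
      · rw [Set.indicator_of_notMem (by simpa using hu0), Set.indicator_of_notMem]
        intro h
        exact hu0 ((NNReal.coe_nonneg _).trans ((le_max_left _ _).trans h.1.le))
    · rw [Set.indicator_of_notMem h1]
      have hz : ∀ u x y, H ((u, ω), (x, y)) = 0 := fun u x y =>
        Set.indicator_of_notMem (s := Prod.fst ⁻¹' S)
          (show (u, ω) ∉ S from fun h => h1 (hω.mem_strip.1 h).1) _
      simp [hz]
  rw [← hl, ← hr]
  exact key

end HawkesRisk

/-! ### Balance of mass over one stage -/

namespace HawkesRisk

section Trajectories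

variable {Ω : Type*} {T : ℕ → Ω → ℝ≥0} {U Y : ℕ → Ω → ℝ} {p : Params}

/-- The value of `F` at time `t` if exactly `k` arrivals have occurred. -/
noncomputable def aliveTerm (T : ℕ → Ω → ℝ≥0) (U Y : ℕ → Ω → ℝ) (F : ℝ × MarkedPath → ℝ≥0∞)
    (k : ℕ) (t : ℝ≥0) (ω : Ω) : ℝ≥0∞ :=
  (prevArrival T k ⁻¹' Set.Iic t ∩ T k ⁻¹' Set.Ioi t).indicator (fun ω => F (t, path T U Y ω)) ω

/-- The value of `F` right after the arrival preceding the `k`-th one if it falls in `(s, t]`. -/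
noncomputable def startTerm (T : ℕ → Ω → ℝ≥0) (U Y : ℕ → Ω → ℝ) (F : ℝ × MarkedPath → ℝ≥0∞)
    (k : ℕ) (s t : ℝ≥0) (ω : Ω) : ℝ≥0∞ :=
  (prevArrival T k ⁻¹' Set.Ioc s t).indicator
    (fun ω => F (prevArrival T k ω, path T U Y ω)) ω

/-- The value of `G` at the `k`-th arrival if it falls in `(s, t]`. -/
noncomputable def jumpTerm (T : ℕ → Ω → ℝ≥0) (U Y : ℕ → Ω → ℝ)
    (G : (ℝ × MarkedPath) × (ℝ × ℝ) → ℝ≥0∞) (k : ℕ) (s t : ℝ≥0) (ω : Ω) : ℝ≥0∞ :=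
  (T k ⁻¹' Set.Ioc s t).indicator (fun ω => G (((T k ω : ℝ), path T U Y ω), (U k ω, Y k ω))) ω

/-- The compensator of the `k`-th arrival in `(s, t]` for an integrand `ψ`. -/
noncomputable def compTerm (p : Params) (T : ℕ → Ω → ℝ≥0) (U Y : ℕ → Ω → ℝ)
    (ψ : ℝ × MarkedPath → ℝ≥0∞) (k : ℕ) (s t : ℝ≥0) (ω : Ω) : ℝ≥0∞ :=
  ∫⁻ u in Set.Ioc (max (prevArrival T k ω : ℝ) s) (min (T k ω : ℝ) t),
    ENNReal.ofReal (intensityAt p k u (path T U Y ω)) * ψ (u, path T U Y ω)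

/-- The expectation over the mark of an integrand. -/
noncomputable def markMean (p : Params) (G : (ℝ × MarkedPath) × (ℝ × ℝ) → ℝ≥0∞)
    (q : ℝ × MarkedPath) : ℝ≥0∞ := ∫⁻ x, ∫⁻ y, G (q, (x, y)) ∂p.FY ∂p.FU

/-- When the stage overlaps `(s, t]`, it is either already running at `s` or begins with an arrival
afterwards, and it either ends with an arrival or is still running at `t`. Exactly one term survives
at each end. -/
lemma Regular.terms_of_meet {ω : Ω} (h : Regular T U Y ω) {k : ℕ} {s t : ℝ≥0} (hst : s ≤ t)
    (h1 : prevArrival T k ω ≤ t) (h2 : s < T k ω) (F : ℝ × MarkedPath → ℝ≥0∞) :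
    max (prevArrival T k ω : ℝ) s ≤ min (T k ω : ℝ) t ∧
    jumpTerm T U Y (fun z => F z.1) k s t ω + aliveTerm T U Y F k t ω =
      F (min (T k ω : ℝ) t, path T U Y ω) ∧
    aliveTerm T U Y F k s ω + startTerm T U Y F k s t ω =
      F (max (prevArrival T k ω : ℝ) s, path T U Y ω) := by
  have h0 := h.prevArrival_lt k
  refine ⟨?_, ?_, ?_⟩
  · refine max_le (le_min ?_ ?_) (le_min ?_ ?_) <;> norm_cast
    exacts [h0.le, h2.le]
  · rcases le_or_gt (T k ω) t with h3 | h3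
    · rw [jumpTerm, aliveTerm, Set.indicator_of_mem (s := T k ⁻¹' Set.Ioc s t) ⟨h2, h3⟩,
        Set.indicator_of_notMem (s := prevArrival T k ⁻¹' Set.Iic t ∩ T k ⁻¹' Set.Ioi t)
          (fun h' => h3.not_gt h'.2), add_zero,
        min_eq_left (by exact_mod_cast h3)]
    · rw [jumpTerm, aliveTerm, Set.indicator_of_notMem (s := T k ⁻¹' Set.Ioc s t)
        (fun h' => h3.not_ge h'.2),
        Set.indicator_of_mem (s := prevArrival T k ⁻¹' Set.Iic t ∩ T k ⁻¹' Set.Ioi t) ⟨h1, h3⟩, zero_add,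
        min_eq_right (by exact_mod_cast h3.le)]
  · rcases le_or_gt (prevArrival T k ω) s with h3 | h3
    · rw [startTerm, aliveTerm,
        Set.indicator_of_mem (s := prevArrival T k ⁻¹' Set.Iic s ∩ T k ⁻¹' Set.Ioi s) ⟨h3, h2⟩,
        Set.indicator_of_notMem (s := prevArrival T k ⁻¹' Set.Ioc s t)
        (fun h' => h3.not_gt h'.1), add_zero, max_eq_right (by exact_mod_cast h3)]
    · rw [startTerm, aliveTerm,
        Set.indicator_of_notMem (s := prevArrival T k ⁻¹' Set.Iic s ∩ T k ⁻¹' Set.Ioi s)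
          (fun h' => h3.not_ge h'.1),
        Set.indicator_of_mem (s := prevArrival T k ⁻¹' Set.Ioc s t) ⟨h3, h1⟩, zero_add,
        max_eq_left (by exact_mod_cast h3.le)]

lemma Regular.terms_of_not_meet {ω : Ω} (h : Regular T U Y ω) {k : ℕ} {s t : ℝ≥0}
    (hst : s ≤ t) (hn : ¬ (prevArrival T k ω ≤ t ∧ s < T k ω))
    (F ψ : ℝ × MarkedPath → ℝ≥0∞) (G : (ℝ × MarkedPath) × (ℝ × ℝ) → ℝ≥0∞) :
    jumpTerm T U Y G k s t ω = 0 ∧ aliveTerm T U Y F k t ω = 0 ∧ aliveTerm T U Y F k s ω = 0 ∧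
      startTerm T U Y F k s t ω = 0 ∧ compTerm p T U Y ψ k s t ω = 0 := by
  have h0 := h.prevArrival_lt k
  refine ⟨Set.indicator_of_notMem ?_ _, Set.indicator_of_notMem ?_ _,
    Set.indicator_of_notMem ?_ _, Set.indicator_of_notMem ?_ _, ?_⟩
  · exact fun h' => hn ⟨h0.le.trans h'.2, h'.1⟩
  · exact fun h' => hn ⟨h'.1, hst.trans_lt h'.2⟩
  · exact fun h' => hn ⟨h'.1.trans hst, h'.2⟩
  · exact fun h' => hn ⟨h'.2, h'.1.trans h0⟩
  · have : min (T k ω : ℝ) t ≤ max (prevArrival T k ω : ℝ) s := by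
      by_contra! h'
      obtain ⟨h3, h4⟩ := max_lt_iff.1 h'
      refine hn ⟨?_, ?_⟩
      · exact_mod_cast (h3.trans_le (min_le_right _ _)).le
      · exact_mod_cast h4.trans_le (min_le_left _ _)
    rw [compTerm, Set.Ioc_eq_empty this.not_gt]
    simp

end Trajectories

variable {Ω : Type*} {mΩ : MeasurableSpace Ω} {P : Measure Ω} {ℱ : Filtration ℝ≥0 mΩ}
  {p : Params} {T : ℕ → Ω → ℝ≥0} {U Y : ℕ → Ω → ℝ}

namespace IsHawkesModel

lemma measurable_aliveTerm (hm : IsHawkesModel p P ℱ T U Y) {F : ℝ × MarkedPath → ℝ≥0∞}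
    (hF : Measurable F) (k : ℕ) (t : ℝ≥0) : Measurable (aliveTerm T U Y F k t) :=
  (hF.comp (measurable_const.prodMk hm.measurable_path)).indicator
    ((hm.measurable_prevArrival k measurableSet_Iic).inter
      (hm.measurable_arrival k measurableSet_Ioi))

lemma measurable_startTerm (hm : IsHawkesModel p P ℱ T U Y) {F : ℝ × MarkedPath → ℝ≥0∞}
    (hF : Measurable F) (k : ℕ) (s t : ℝ≥0) : Measurable (startTerm T U Y F k s t) :=
  (hF.comp ((hm.measurable_prevArrival k).coe_nnreal_real.prodMk hm.measurable_path)).indicator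
    (hm.measurable_prevArrival k measurableSet_Ioc)

lemma measurable_jumpTerm (hm : IsHawkesModel p P ℱ T U Y)
    {G : (ℝ × MarkedPath) × (ℝ × ℝ) → ℝ≥0∞}
    (hG : Measurable G) (k : ℕ) (s t : ℝ≥0) : Measurable (jumpTerm T U Y G k s t) :=
  (hG.comp (((hm.measurable_arrival k).coe_nnreal_real.prodMk hm.measurable_path).prodMk
    ((hm.measurable_claim k).prodMk (hm.measurable_shock k)))).indicator
    (hm.measurable_arrival k measurableSet_Ioc)

lemma lintegral_jumpTerm (hm : IsHawkesModel p P ℱ T U Y) (hp : p.Admissible)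
    {A : Set Ω} {s : ℝ≥0} (hA : MeasurableSet[ℱ s] A) (t : ℝ≥0) (k m : ℕ)
    {G : (ℝ × MarkedPath) × (ℝ × ℝ) → ℝ≥0∞} (hG : Measurable G) (hGk : DependsOnFirst k G) :
    ∫⁻ ω in A ∩ boundedMarks U Y k m, jumpTerm T U Y G k s t ω ∂P =
      ∫⁻ ω in A ∩ boundedMarks U Y k m, compTerm p T U Y (markMean p G) k s t ω ∂P :=
  hm.lintegral_arrival hp hA t k m hG hGk

/-- For an integrand without marks the mark laws integrate to one. This equates the expected value
just before the arrival with the compensator term that cancels in `stage_le` and `le_stage`. -/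
lemma lintegral_jumpTerm_unmarked (hm : IsHawkesModel p P ℱ T U Y) (hp : p.Admissible)
    {A : Set Ω} {s : ℝ≥0} (hA : MeasurableSet[ℱ s] A) (t : ℝ≥0) (k m : ℕ)
    {F : ℝ × MarkedPath → ℝ≥0∞} (hF : Measurable F)
    (hFk : DependsOnFirst k (fun z => F z.1)) :
    ∫⁻ ω in A ∩ boundedMarks U Y k m, jumpTerm T U Y (fun z => F z.1) k s t ω ∂P =
      ∫⁻ ω in A ∩ boundedMarks U Y k m, compTerm p T U Y F k s t ω ∂P := by
  have := hp.prob_FU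
  have := hp.prob_FY
  have h := hm.lintegral_jumpTerm hp hA t k m (hF.comp measurable_fst) hFk
  have he : markMean p (F ∘ Prod.fst) = F := by ext q; simp [markMean]
  rw [he] at h
  exact h

lemma lintegral_compTerm_ne_top [IsFiniteMeasure P]
    (hm : IsHawkesModel p P ℱ T U Y) {A : Set Ω} {s t : ℝ≥0} {k m : ℕ} {F : ℝ × MarkedPath → ℝ≥0∞}
    (hA : MeasurableSet A)
    {C : ℝ≥0} (hC : ∀ᵐ ω ∂P, ω ∈ boundedMarks U Y k m →
      ∀ u : ℝ, (prevArrival T k ω : ℝ) ≤ u → u ≤ t →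
        ENNReal.ofReal (intensityAt p k u (path T U Y ω)) * F (u, path T U Y ω) ≤ C) :
    ∫⁻ ω in A ∩ boundedMarks U Y k m, compTerm p T U Y F k s t ω ∂P ≠ ⊤ := by
  have hAm := hA.inter (hm.measurableSet_boundedMarks k m)
  have hle : ∫⁻ ω in A ∩ boundedMarks U Y k m, compTerm p T U Y F k s t ω ∂P ≤
      ∫⁻ ω in A ∩ boundedMarks U Y k m, (C * t : ℝ≥0) ∂P := by
    refine lintegral_mono_ae ?_
    filter_upwards [ae_restrict_of_ae hC, ae_restrict_mem hAm] with ω h1 h2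
    calc compTerm p T U Y F k s t ω ≤
        ∫⁻ u in Set.Ioc (max (prevArrival T k ω : ℝ) s) (min (T k ω : ℝ) t), (C : ℝ≥0∞) := by
          refine setLIntegral_mono measurable_const fun u hu => h1 h2.2 u ?_ ?_
          · exact (le_max_left _ _).trans hu.1.le
          · exact hu.2.trans (min_le_right _ _)
      _ ≤ (C * t : ℝ≥0) := by
          rw [setLIntegral_const, Real.volume_Ioc, ENNReal.coe_mul]
          gcongr
          rw [← ENNReal.ofReal_coe_nnreal]
          refine ENNReal.ofReal_le_ofReal ?_
          have := (NNReal.coe_nonneg (prevArrival T k ω)).trans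
            (le_max_left (prevArrival T k ω : ℝ) s)
          have := min_le_right (T k ω : ℝ) t
          linarith
  refine ne_top_of_le_ne_top ?_ hle
  rw [lintegral_const]
  exact ENNReal.mul_ne_top ENNReal.coe_ne_top (measure_ne_top _ _)

/-- Finitely many marks are bounded on each trajectory, so the truncation sets increase to `A` and
monotone convergence applies. -/
lemma setLIntegral_le_of_boundedMarks {A : Set Ω}
    (k : ℕ) {f g : Ω → ℝ≥0∞}
    (h : ∀ m, ∫⁻ ω in A ∩ boundedMarks U Y k m, f ω ∂P ≤
      ∫⁻ ω in A ∩ boundedMarks U Y k m, g ω ∂P) :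
    ∫⁻ ω in A, f ω ∂P ≤ ∫⁻ ω in A, g ω ∂P := by
  have hmono : Monotone fun m => A ∩ boundedMarks U Y k m := fun m m' hmm ω hω =>
    ⟨hω.1, fun i hi => ⟨(hω.2 i hi).1.trans (by exact_mod_cast hmm),
      (hω.2 i hi).2.trans (by exact_mod_cast hmm)⟩⟩
  have hU : A = ⋃ m, A ∩ boundedMarks U Y k m := by
    ext ω
    simp only [Set.mem_iUnion, Set.mem_inter_iff, exists_and_left, iff_self_and]
    intro _
    obtain ⟨m, hm⟩ := exists_nat_ge (∑ i ∈ Finset.range k, (|U i ω| + |Y i ω|))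
    have hle : ∀ i < k, |U i ω| + |Y i ω| ≤ m := fun i hi =>
      (Finset.single_le_sum (f := fun i => |U i ω| + |Y i ω|)
        (fun _ _ => by positivity) (Finset.mem_range.2 hi)).trans hm
    exact ⟨m, fun i hi => ⟨by linarith [hle i hi, abs_nonneg (Y i ω)],
      by linarith [hle i hi, abs_nonneg (U i ω)]⟩⟩
  rw [hU, setLIntegral_iUnion_of_directed _ hmono.directed_le,
    setLIntegral_iUnion_of_directed _ hmono.directed_le]
  exact iSup_mono h

lemma lintegral_end_add_comp (hm : IsHawkesModel p P ℱ T U Y) (hp : p.Admissible)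
    {A : Set Ω} {s t : ℝ≥0} (hA : MeasurableSet[ℱ s] A) {k m : ℕ}
    {F : ℝ × MarkedPath → ℝ≥0∞} (hF : Measurable F) (hFk : DependsOnFirst k (fun z => F z.1))
    {G : (ℝ × MarkedPath) × (ℝ × ℝ) → ℝ≥0∞} (hG : Measurable G) (hGk : DependsOnFirst k G) :
    ∫⁻ ω in A ∩ boundedMarks U Y k m,
        ((jumpTerm T U Y (fun z => F z.1) k s t ω + aliveTerm T U Y F k t ω) +
          compTerm p T U Y (markMean p G) k s t ω) ∂P =
      ∫⁻ ω in A ∩ boundedMarks U Y k m, compTerm p T U Y F k s t ω ∂P +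
        ∫⁻ ω in A ∩ boundedMarks U Y k m,
          (aliveTerm T U Y F k t ω + jumpTerm T U Y G k s t ω) ∂P := by
  have h1 : Measurable (jumpTerm T U Y (fun z => F z.1) k s t) :=
    hm.measurable_jumpTerm (hF.comp measurable_fst) k s t
  have h2 := hm.measurable_aliveTerm hF k t
  have h3 : Measurable fun ω =>
      jumpTerm T U Y (fun z => F z.1) k s t ω + aliveTerm T U Y F k t ω := h1.add h2
  rw [lintegral_add_left h3, lintegral_add_left h1, lintegral_add_left h2,
    hm.lintegral_jumpTerm_unmarked hp hA t k m hF hFk, hm.lintegral_jumpTerm hp hA t k m hG hGk,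
    add_assoc]

lemma lintegral_start_add_comp (hm : IsHawkesModel p P ℱ T U Y)
    {A : Set Ω} {s t : ℝ≥0} {k m : ℕ} {F : ℝ × MarkedPath → ℝ≥0∞} (hF : Measurable F) :
    ∫⁻ ω in A ∩ boundedMarks U Y k m,
        ((aliveTerm T U Y F k s ω + startTerm T U Y F k s t ω) + compTerm p T U Y F k s t ω) ∂P =
      ∫⁻ ω in A ∩ boundedMarks U Y k m, compTerm p T U Y F k s t ω ∂P +
        ∫⁻ ω in A ∩ boundedMarks U Y k m,
          (aliveTerm T U Y F k s ω + startTerm T U Y F k s t ω) ∂P := by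
  have h : Measurable fun ω => aliveTerm T U Y F k s ω + startTerm T U Y F k s t ω :=
    (hm.measurable_aliveTerm hF k s).add (hm.measurable_startTerm hF k s t)
  rw [lintegral_add_left h, add_comm]

/-- Between two arrivals, a process that decreases on average after compensation. -/
lemma stage_le [IsFiniteMeasure P] (hm : IsHawkesModel p P ℱ T U Y) (hp : p.Admissible)
    {A : Set Ω} {s t : ℝ≥0} (hst : s ≤ t) (hA : MeasurableSet[ℱ s] A) (k : ℕ)
    {F : ℝ × MarkedPath → ℝ≥0∞} (hF : Measurable F) (hFk : DependsOnFirst k (fun z => F z.1))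
    {G : (ℝ × MarkedPath) × (ℝ × ℝ) → ℝ≥0∞} (hG : Measurable G) (hGk : DependsOnFirst k G)
    (hfin : ∀ m : ℕ, ∃ C : ℝ≥0, ∀ᵐ ω ∂P, ω ∈ boundedMarks U Y k m →
      ∀ u : ℝ, (prevArrival T k ω : ℝ) ≤ u → u ≤ t →
        ENNReal.ofReal (intensityAt p k u (path T U Y ω)) * F (u, path T U Y ω) ≤ C)
    (hpath : ∀ᵐ ω ∂P, ∀ l v : ℝ, (prevArrival T k ω : ℝ) ≤ l → l ≤ v → v ≤ t →
      F (v, path T U Y ω) + ∫⁻ u in Set.Ioc l v,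
          ENNReal.ofReal (intensityAt p k u (path T U Y ω)) * markMean p G (u, path T U Y ω) ≤
        F (l, path T U Y ω) + ∫⁻ u in Set.Ioc l v,
          ENNReal.ofReal (intensityAt p k u (path T U Y ω)) * F (u, path T U Y ω)) :
    ∫⁻ ω in A, (aliveTerm T U Y F k t ω + jumpTerm T U Y G k s t ω) ∂P ≤
      ∫⁻ ω in A, (aliveTerm T U Y F k s ω + startTerm T U Y F k s t ω) ∂P := by
  refine setLIntegral_le_of_boundedMarks (U := U) (Y := Y) k fun m => ?_
  obtain ⟨C, hC⟩ := hfin m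
  -- The term common to both sides must be finite to be cancelled in `ℝ≥0∞`.
  have hB := hm.lintegral_compTerm_ne_top (s := s) (ℱ.le s _ hA) hC
  have hae : ∀ᵐ ω ∂P, (jumpTerm T U Y (fun z => F z.1) k s t ω + aliveTerm T U Y F k t ω) +
      compTerm p T U Y (markMean p G) k s t ω ≤
      (aliveTerm T U Y F k s ω + startTerm T U Y F k s t ω) + compTerm p T U Y F k s t ω := by
    filter_upwards [hm.ae_regular hp, hpath] with ω hω h
    by_cases hmeet : prevArrival T k ω ≤ t ∧ s < T k ω
    · obtain ⟨h1, h2, h3⟩ := hω.terms_of_meet hst hmeet.1 hmeet.2 F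
      rw [h2, h3]
      exact h _ _ (le_max_left _ _) h1 (min_le_right _ _)
    · obtain ⟨h1, h2, -, -, h5⟩ := hω.terms_of_not_meet (p := p) hst hmeet F (markMean p G)
        (fun z => F z.1)
      rw [h1, h2, h5]
      simp
  have hint := lintegral_mono_ae (ae_restrict_of_ae (s := A ∩ boundedMarks U Y k m) hae)
  rw [hm.lintegral_end_add_comp hp hA hF hFk hG hGk, hm.lintegral_start_add_comp hF] at hint
  exact (ENNReal.add_le_add_iff_left hB).1 hint

/-- Between two arrivals, a process that increases on average after compensation. -/
lemma le_stage [IsFiniteMeasure P] (hm : IsHawkesModel p P ℱ T U Y) (hp : p.Admissible)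
    {A : Set Ω} {s t : ℝ≥0} (hst : s ≤ t) (hA : MeasurableSet[ℱ s] A) (k : ℕ)
    {F : ℝ × MarkedPath → ℝ≥0∞} (hF : Measurable F) (hFk : DependsOnFirst k (fun z => F z.1))
    {G : (ℝ × MarkedPath) × (ℝ × ℝ) → ℝ≥0∞} (hG : Measurable G) (hGk : DependsOnFirst k G)
    (hfin : ∀ m : ℕ, ∃ C : ℝ≥0, ∀ᵐ ω ∂P, ω ∈ boundedMarks U Y k m →
      ∀ u : ℝ, (prevArrival T k ω : ℝ) ≤ u → u ≤ t →
        ENNReal.ofReal (intensityAt p k u (path T U Y ω)) * F (u, path T U Y ω) ≤ C)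
    (hpath : ∀ᵐ ω ∂P, ∀ l v : ℝ, (prevArrival T k ω : ℝ) ≤ l → l ≤ v → v ≤ t →
      F (l, path T U Y ω) + ∫⁻ u in Set.Ioc l v,
          ENNReal.ofReal (intensityAt p k u (path T U Y ω)) * F (u, path T U Y ω) ≤
        F (v, path T U Y ω) + ∫⁻ u in Set.Ioc l v,
          ENNReal.ofReal (intensityAt p k u (path T U Y ω)) * markMean p G (u, path T U Y ω)) :
    ∫⁻ ω in A, (aliveTerm T U Y F k s ω + startTerm T U Y F k s t ω) ∂P ≤
      ∫⁻ ω in A, (aliveTerm T U Y F k t ω + jumpTerm T U Y G k s t ω) ∂P := by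
  refine setLIntegral_le_of_boundedMarks (U := U) (Y := Y) k fun m => ?_
  obtain ⟨C, hC⟩ := hfin m
  have hB := hm.lintegral_compTerm_ne_top (s := s) (ℱ.le s _ hA) hC
  have hae : ∀ᵐ ω ∂P,
      (aliveTerm T U Y F k s ω + startTerm T U Y F k s t ω) + compTerm p T U Y F k s t ω ≤
      (jumpTerm T U Y (fun z => F z.1) k s t ω + aliveTerm T U Y F k t ω) +
      compTerm p T U Y (markMean p G) k s t ω := by
    filter_upwards [hm.ae_regular hp, hpath] with ω hω h
    by_cases hmeet : prevArrival T k ω ≤ t ∧ s < T k ω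
    · obtain ⟨h1, h2, h3⟩ := hω.terms_of_meet hst hmeet.1 hmeet.2 F
      rw [h2, h3]
      exact h _ _ (le_max_left _ _) h1 (min_le_right _ _)
    · obtain ⟨-, -, h3, h4, h5⟩ := hω.terms_of_not_meet (p := p) hst hmeet F F
        (fun z => F z.1)
      rw [h3, h4, h5]
      simp
  have hint := lintegral_mono_ae (ae_restrict_of_ae (s := A ∩ boundedMarks U Y k m) hae)
  rw [hm.lintegral_end_add_comp hp hA hF hFk hG hGk, hm.lintegral_start_add_comp hF] at hint
  exact (ENNReal.add_le_add_iff_left hB).1 hint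

end IsHawkesModel
end HawkesRisk

/-! ### Jump means and the two pathwise balances -/

namespace HawkesRisk

/-- The mean of the jump factor. -/
noncomputable def Params.jumpMean (p : Params) (r : ℝ) : ℝ :=
  mgf id p.FU r * mgf id p.FY (-p.alpha r)

/-- The mean of the jump factor times the shock. -/
noncomputable def Params.jumpShockMean (p : Params) (r : ℝ) : ℝ :=
  mgf id p.FU r * ∫ y, y * Real.exp (-p.alpha r * y) ∂p.FY

section Deterministic

variable {p : Params} {r : ℝ} {k : ℕ}

lemma Params.AlphaDefined.jumpMean_eq (hα : p.AlphaDefined r) :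
    p.alpha r * p.β + p.jumpMean r = 1 := by
  have := hα.1.2.2
  unfold Params.jumpMean
  linarith

lemma Params.jumpMean_nonneg : 0 ≤ p.jumpMean r := mul_nonneg mgf_nonneg mgf_nonneg

lemma Params.Admissible.jumpShockMean_nonneg (hp : p.Admissible) : 0 ≤ p.jumpShockMean r := by
  refine mul_nonneg mgf_nonneg (integral_nonneg_of_ae ?_)
  filter_upwards [hp.FY_pos] with y hy
  exact mul_nonneg hy.le (Real.exp_pos _).le

/-- The affine factor serves both integrands: `c₁ = 0` gives `expJump`, while `wtJump` needs the
term linear in the shock. -/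
lemma lintegral_jumpFactor (hp : p.Admissible) (hα : p.AlphaDefined r) {c₀ c₁ : ℝ}
    (h₀ : 0 ≤ c₀) (h₁ : 0 ≤ c₁) :
    ∫⁻ x, ∫⁻ y, ENNReal.ofReal (jumpFactor p r (x, y) * (c₀ + c₁ * y)) ∂p.FY ∂p.FU =
      ENNReal.ofReal (c₀ * p.jumpMean r + c₁ * p.jumpShockMean r) := by
  obtain ⟨hU, hY, -⟩ := hα.1
  have i0 : Integrable (fun y : ℝ => Real.exp (-p.alpha r * y)) p.FY := hY
  -- Steepness enters here: `-α(r)` is interior to the domain of `M_Y`, so the first exponential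
  -- moment is finite.
  have i1 : Integrable (fun y : ℝ => y * Real.exp (-p.alpha r * y)) p.FY := by
    simpa using integrable_pow_mul_exp_of_mem_interior_integrableExpSet
      (hp.FY_steep.mem_interior hp.FY_pos hY) 1
  have iU : Integrable (fun x : ℝ => Real.exp (r * x)) p.FU := hU
  have m1 : 0 ≤ ∫ y, y * Real.exp (-p.alpha r * y) ∂p.FY := by
    refine integral_nonneg_of_ae ?_
    filter_upwards [hp.FY_pos] with y hy
    exact mul_nonneg hy.le (Real.exp_pos _).le
  set K := c₀ * mgf id p.FY (-p.alpha r) + c₁ * ∫ y, y * Real.exp (-p.alpha r * y) ∂p.FY with hK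
  have hK0 : 0 ≤ K := add_nonneg (mul_nonneg h₀ mgf_nonneg) (mul_nonneg h₁ m1)
  have hin : ∀ x : ℝ, ∫⁻ y, ENNReal.ofReal (jumpFactor p r (x, y) * (c₀ + c₁ * y)) ∂p.FY =
      ENNReal.ofReal (Real.exp (r * x) * K) := fun x => by
    have e : ∀ y, jumpFactor p r (x, y) * (c₀ + c₁ * y) = Real.exp (r * x) *
        (c₀ * Real.exp (-p.alpha r * y) + c₁ * (y * Real.exp (-p.alpha r * y))) := fun y => by
      simp only [jumpFactor]; ring
    simp_rw [e]
    rw [← ofReal_integral_eq_lintegral_ofReal, integral_const_mul,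
      integral_add (i0.const_mul _) (i1.const_mul _), integral_const_mul, integral_const_mul]
    · rfl
    · exact ((i0.const_mul _).add (i1.const_mul _)).const_mul _
    · filter_upwards [hp.FY_pos] with y hy
      simp only [Pi.zero_apply]
      positivity
  simp_rw [hin]
  rw [← ofReal_integral_eq_lintegral_ofReal (iU.mul_const _)
    (ae_of_all _ fun x => mul_nonneg (Real.exp_pos _).le hK0), integral_mul_const]
  congr 1
  have : mgf id p.FU r = ∫ x, Real.exp (r * x) ∂p.FU := rfl
  rw [Params.jumpMean, Params.jumpShockMean, ← this, hK]
  ring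

/-- The exponential process with `k` arrivals as an extended nonnegative function. -/
noncomputable def expVal (p : Params) (r : ℝ) (k : ℕ) (q : ℝ × MarkedPath) : ℝ≥0∞ :=
  ENNReal.ofReal (expAt p r k q.1 q.2)

/-- The exponential process right after an arrival. -/
noncomputable def expJump (p : Params) (r : ℝ) (k : ℕ) (z : (ℝ × MarkedPath) × (ℝ × ℝ)) : ℝ≥0∞ :=
  ENNReal.ofReal (jumpFactor p r z.2 * expAt p r k z.1.1 z.1.2)

/-- The rate at which the intensity may grow on average under the changed measure. -/
noncomputable def Params.growth (p : Params) (r : ℝ) : ℝ := p.jumpMean r + p.jumpShockMean r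

/-- The exponential process times the discounted intensity. -/
noncomputable def wtVal (p : Params) (r : ℝ) (k : ℕ) (q : ℝ × MarkedPath) : ℝ≥0∞ :=
  ENNReal.ofReal (expAt p r k q.1 q.2 * (intensityAt p k q.1 q.2 * Real.exp (-p.growth r * q.1)))

/-- The exponential process times the discounted intensity right after an arrival, plus a small
multiple of the exponential process itself. -/
noncomputable def wtJump (p : Params) (r t : ℝ) (k : ℕ) (z : (ℝ × MarkedPath) × (ℝ × ℝ)) : ℝ≥0∞ :=
  ENNReal.ofReal (jumpFactor p r z.2 *
    (expAt p r k z.1.1 z.1.2 * (intensityAt p k z.1.1 z.1.2 * Real.exp (-p.growth r * z.1.1) +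
      Real.exp (-p.growth r * t)) +
      expAt p r k z.1.1 z.1.2 * Real.exp (-p.growth r * z.1.1) * z.2.2))

lemma measurable_expVal : Measurable (expVal p r k) := measurable_expAt.ennreal_ofReal

lemma measurable_expJump : Measurable (expJump p r k) :=
  ((measurable_jumpFactor.comp measurable_snd).mul
    (measurable_expAt.comp measurable_fst)).ennreal_ofReal

lemma measurable_wtVal : Measurable (wtVal p r k) := by
  have h1 := measurable_expAt (p := p) (r := r) (k := k)
  have h2 := measurable_intensityAt (p := p) (k := k)
  unfold wtVal
  fun_prop

lemma measurable_wtJump (t : ℝ) : Measurable (wtJump p r t k) := by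
  have h1 : Measurable fun z : (ℝ × MarkedPath) × (ℝ × ℝ) => expAt p r k z.1.1 z.1.2 :=
    (measurable_expAt (p := p) (r := r) (k := k)).comp measurable_fst
  have h2 : Measurable fun z : (ℝ × MarkedPath) × (ℝ × ℝ) => intensityAt p k z.1.1 z.1.2 :=
    (measurable_intensityAt (p := p) (k := k)).comp measurable_fst
  have h3 : Measurable fun z : (ℝ × MarkedPath) × (ℝ × ℝ) => jumpFactor p r z.2 :=
    (measurable_jumpFactor (p := p) (r := r)).comp measurable_snd
  unfold wtJump
  fun_prop

lemma dependsOnFirst_expVal : DependsOnFirst k fun z => expVal p r k z.1 :=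
  fun u z d d' h1 h2 h3 => by simp only [expVal, expAt_congr h1 h2 h3]

lemma dependsOnFirst_expJump : DependsOnFirst k (expJump p r k) :=
  fun u z d d' h1 h2 h3 => by simp only [expJump, expAt_congr h1 h2 h3]

lemma dependsOnFirst_wtVal : DependsOnFirst k fun z => wtVal p r k z.1 :=
  fun u z d d' h1 h2 h3 => by simp only [wtVal, expAt_congr h1 h2 h3, intensityAt_congr h1 h3]

lemma dependsOnFirst_wtJump (t : ℝ) : DependsOnFirst k (wtJump p r t k) :=
  fun u z d d' h1 h2 h3 => by simp only [wtJump, expAt_congr h1 h2 h3, intensityAt_congr h1 h3]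

lemma markMean_expJump (hp : p.Admissible) (hα : p.AlphaDefined r) (q : ℝ × MarkedPath) :
    markMean p (expJump p r k) q = ENNReal.ofReal (expAt p r k q.1 q.2 * p.jumpMean r) := by
  have := lintegral_jumpFactor hp hα (expAt_nonneg (p := p) (r := r) (k := k) (d := q.2) q.1)
    le_rfl
  simpa [markMean, expJump] using this

lemma markMean_wtJump (hp : p.Admissible) (hα : p.AlphaDefined r) (t u : ℝ) {d : MarkedPath}
    (hq : 0 ≤ intensityAt p k u d) :
    markMean p (wtJump p r t k) (u, d) = ENNReal.ofReal
      (expAt p r k u d * (intensityAt p k u d * Real.exp (-p.growth r * u) +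
        Real.exp (-p.growth r * t)) * p.jumpMean r +
      expAt p r k u d * Real.exp (-p.growth r * u) * p.jumpShockMean r) := by
  rw [← lintegral_jumpFactor hp hα
    (mul_nonneg (expAt_nonneg _) (add_nonneg (mul_nonneg hq (Real.exp_pos _).le)
      (Real.exp_pos _).le))
    (mul_nonneg (expAt_nonneg _) (Real.exp_pos _).le)]
  rfl

/-- Drift `αβΛM` plus compensated jumps `κΛM` make `ΛM`, because `αβ + κ = 1`. -/
lemma expVal_balance (hp : p.Admissible) (hα : p.AlphaDefined r) {d : MarkedPath}
    (hd : ∀ i < k, 0 ≤ d.2.2 i) {l v : ℝ} (hlv : l ≤ v) :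
    expVal p r k (v, d) + ∫⁻ u in Set.Ioc l v,
        ENNReal.ofReal (intensityAt p k u d) * markMean p (expJump p r k) (u, d) =
      expVal p r k (l, d) + ∫⁻ u in Set.Ioc l v,
        ENNReal.ofReal (intensityAt p k u d) * expVal p r k (u, d) := by
  have hΛ : ∀ u, 0 ≤ intensityAt p k u d := fun u => hp.a_pos.le.trans (le_intensityAt hp hd u)
  have hM : ∀ u, 0 ≤ expAt p r k u d := expAt_nonneg
  have cΛ : Continuous fun u => intensityAt p k u d := continuous_intensityAt
  have cM : Continuous fun u => expAt p r k u d := continuous_expAt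
  have hκ : 0 ≤ p.jumpMean r := Params.jumpMean_nonneg
  have hαβ := hα.jumpMean_eq
  simp only [markMean_expJump hp hα, expVal, ← ENNReal.ofReal_mul (hΛ _)]
  have e : ∀ u, p.alpha r * p.β * intensityAt p k u d * expAt p r k u d +
      intensityAt p k u d * (expAt p r k u d * p.jumpMean r) =
      intensityAt p k u d * expAt p r k u d := fun u => by
    rw [show p.alpha r * p.β = 1 - p.jumpMean r by linarith]; ring
  refine le_antisymm
    (ofReal_add_lintegral_le hlv hasDerivAt_expAt (by fun_prop) (by fun_prop) (by fun_prop)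
      (fun x _ => hM x) (fun x _ => ?_) (fun x _ => mul_nonneg (hΛ x) (hM x)) fun x _ => (e x).le)
    (le_ofReal_add_lintegral hlv hasDerivAt_expAt (by fun_prop) (by fun_prop) (by fun_prop)
      (fun x _ => hM x) (fun x _ => ?_) (fun x _ => mul_nonneg (hΛ x) (hM x)) fun x _ => (e x).ge)
  all_goals exact mul_nonneg (hΛ x) (mul_nonneg (hM x) hκ)

lemma hasDerivAt_wt {d : MarkedPath} (u : ℝ) :
    HasDerivAt (fun u => expAt p r k u d * (intensityAt p k u d * Real.exp (-p.growth r * u)))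
      (p.alpha r * p.β * intensityAt p k u d * expAt p r k u d *
          (intensityAt p k u d * Real.exp (-p.growth r * u)) +
        expAt p r k u d * (-p.β * (intensityAt p k u d - p.a) * Real.exp (-p.growth r * u) +
          intensityAt p k u d * (Real.exp (-p.growth r * u) * -p.growth r))) u := by
  have h : HasDerivAt (fun u : ℝ => Real.exp (-p.growth r * u))
      (Real.exp (-p.growth r * u) * -p.growth r) u := by
    simpa using ((hasDerivAt_id u).const_mul (-p.growth r)).exp
  exact (hasDerivAt_expAt u).mul ((hasDerivAt_intensityAt u).mul h)

/-- With `E`, `D` the discount factors at `x` and `t`, substituting `αβ = 1 - κ` and `γ = κ + κ'`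
leaves the surplus `Mβ(Λ - a)E + κΛM(E - D)`. Both terms are nonnegative: the intensity never falls
below `a`, and `x ≤ t`. -/
lemma wtVal_balance (hp : p.Admissible) (hα : p.AlphaDefined r) {d : MarkedPath}
    (hd : ∀ i < k, 0 ≤ d.2.2 i) {l v t : ℝ} (hlv : l ≤ v) (hvt : v ≤ t) :
    wtVal p r k (v, d) + ∫⁻ u in Set.Ioc l v,
        ENNReal.ofReal (intensityAt p k u d) * markMean p (wtJump p r t k) (u, d) ≤
      wtVal p r k (l, d) + ∫⁻ u in Set.Ioc l v,
        ENNReal.ofReal (intensityAt p k u d) * wtVal p r k (u, d) := by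
  have hΛa : ∀ u, p.a ≤ intensityAt p k u d := le_intensityAt hp hd
  have hΛ : ∀ u, 0 ≤ intensityAt p k u d := fun u => hp.a_pos.le.trans (hΛa u)
  have hM : ∀ u, 0 ≤ expAt p r k u d := expAt_nonneg
  have cΛ : Continuous fun u => intensityAt p k u d := continuous_intensityAt
  have cM : Continuous fun u => expAt p r k u d := continuous_expAt
  have hκ : 0 ≤ p.jumpMean r := Params.jumpMean_nonneg
  have hκ' : 0 ≤ p.jumpShockMean r := hp.jumpShockMean_nonneg
  have hαβ := hα.jumpMean_eq
  have hg : p.growth r = p.jumpMean r + p.jumpShockMean r := rfl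
  have hmean := fun u => markMean_wtJump hp hα t u (hΛ u)
  simp only [hmean, wtVal, ← ENNReal.ofReal_mul (hΛ _)]
  refine ofReal_add_lintegral_le hlv hasDerivAt_wt (by fun_prop) (by fun_prop) (by fun_prop)
    (fun x _ => ?_) (fun x _ => ?_) (fun x _ => ?_) fun x hx => ?_
  · have := hM x; have := hΛ x; positivity
  · have := hM x; have := hΛ x; positivity
  · have := hM x; have := hΛ x; positivity
  · have h1 := hM x
    have h2 := hΛ x
    have h3 : Real.exp (-p.growth r * t) ≤ Real.exp (-p.growth r * x) := by
      refine Real.exp_le_exp.2 ?_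
      have : 0 ≤ p.growth r := by rw [hg]; positivity
      nlinarith [hx.2]
    set E := Real.exp (-p.growth r * x)
    set D := Real.exp (-p.growth r * t)
    set Λ := intensityAt p k x d
    set M := expAt p r k x d
    have hE : 0 < E := Real.exp_pos _
    rw [show p.alpha r * p.β = 1 - p.jumpMean r by linarith, hg]
    have t1 : 0 ≤ M * (p.β * (Λ - p.a) * E) := by
      have := hΛa x
      have : 0 ≤ Λ - p.a := by simp only [Λ]; linarith
      have := hp.β_pos
      positivity
    have t2 : 0 ≤ M * Λ * p.jumpMean r * (E - D) := by
      have : 0 ≤ E - D := by linarith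
      positivity
    nlinarith

lemma expAt_zero_zero (d : MarkedPath) : expAt p r 0 0 d = 1 := by
  simp only [expAt, intensityAt, Finset.range_zero, Finset.sum_empty, ← Real.exp_add]
  rw [Real.exp_eq_one_iff]
  simp

lemma intensityAt_zero_zero (d : MarkedPath) : intensityAt p 0 0 d = p.lam := by
  simp [intensityAt]

end Deterministic

end HawkesRisk

/-! ### Telescoping over arrivals and absence of explosion -/

namespace HawkesRisk

variable {Ω : Type*} {T : ℕ → Ω → ℝ≥0} {U Y : ℕ → Ω → ℝ} {p : Params} {r : ℝ}

/-- Mass leaving stage `k` through an arrival is the mass entering stage `k + 1`; this makes the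
stages telescope. -/
lemma jumpTerm_expJump (k : ℕ) (s t : ℝ≥0) (ω : Ω) :
    jumpTerm T U Y (expJump p r k) k s t ω =
      startTerm T U Y (expVal p r (k + 1)) (k + 1) s t ω := by
  have h : expJump p r k (((T k ω : ℝ), path T U Y ω), (U k ω, Y k ω)) =
      expVal p r (k + 1) (T k ω, path T U Y ω) := by
    have := expAt_succ (p := p) (r := r) (k := k) (path T U Y ω)
    simp only [path] at this
    simp only [expJump, expVal, path, this, mul_comm]
  by_cases hT : T k ω ∈ Set.Ioc s t <;> simp [jumpTerm, startTerm, prevArrival, hT, h]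

lemma Regular.intensityAt_nonneg {ω : Ω} (h : Regular T U Y ω) (hp : p.Admissible) (k : ℕ)
    (u : ℝ) : 0 ≤ intensityAt p k u (path T U Y ω) :=
  hp.a_pos.le.trans (le_intensityAt hp (fun i _ => (h.shock_pos i).le) u)

lemma Regular.jumpTerm_wtJump {ω : Ω} (h : Regular T U Y ω) (hp : p.Admissible) (k : ℕ)
    (s t : ℝ≥0) :
    jumpTerm T U Y (wtJump p r t k) k s t ω =
      startTerm T U Y (wtVal p r (k + 1)) (k + 1) s t ω +
        ENNReal.ofReal (Real.exp (-p.growth r * t)) *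
          startTerm T U Y (expVal p r (k + 1)) (k + 1) s t ω := by
  have h : wtJump p r t k (((T k ω : ℝ), path T U Y ω), (U k ω, Y k ω)) =
      wtVal p r (k + 1) (T k ω, path T U Y ω) + ENNReal.ofReal (Real.exp (-p.growth r * t)) *
        expVal p r (k + 1) (T k ω, path T U Y ω) := by
    have h1 := expAt_succ (p := p) (r := r) (k := k) (path T U Y ω)
    have h2 := intensityAt_succ (p := p) (k := k) (path T U Y ω)
    have h3 := h.intensityAt_nonneg hp (k + 1) (T k ω)
    have h4 := expAt_nonneg (p := p) (r := r) (k := k + 1) (d := path T U Y ω) (T k ω)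
    rw [wtVal, expVal, ← ENNReal.ofReal_mul (Real.exp_pos _).le,
      ← ENNReal.ofReal_add (by positivity) (by positivity), wtJump]
    congr 1
    simp only [path] at h1 h2 ⊢
    rw [h1, h2]
    ring
  by_cases hT : T k ω ∈ Set.Ioc s t <;> simp [jumpTerm, startTerm, prevArrival, hT, h]

lemma startTerm_zero (F : ℝ × MarkedPath → ℝ≥0∞) (s t : ℝ≥0) (ω : Ω) :
    startTerm T U Y F 0 s t ω = 0 := by
  simp [startTerm, prevArrival]

lemma startTerm_mono (F : ℝ × MarkedPath → ℝ≥0∞) (k : ℕ) (s t : ℝ≥0) (ω : Ω) :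
    startTerm T U Y F k s t ω ≤ startTerm T U Y F k 0 t ω :=
  Set.indicator_le_indicator_of_subset
    (Set.preimage_mono (f := prevArrival T k) (Set.Ioc_subset_Ioc_left zero_le))
    (fun _ => zero_le) ω

lemma Regular.tsum_aliveTerm {ω : Ω} (h : Regular T U Y ω) (t : ℝ≥0) :
    ∑' k, aliveTerm T U Y (expVal p r k) k t ω = ENNReal.ofReal (expMart p T U Y r t ω) := by
  obtain ⟨k, h1, h2⟩ := h.exists_count t
  rw [tsum_eq_single k, aliveTerm, Set.indicator_of_mem
    (s := prevArrival T k ⁻¹' Set.Iic t ∩ T k ⁻¹' Set.Ioi t) ⟨h1, h2⟩,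
    expMart_eq, h.count_eq h1 h2, expVal]
  intro n hn
  refine Set.indicator_of_notMem (fun h' => hn ?_) _
  rw [← h.count_eq h1 h2, h.count_eq h'.1 h'.2]

variable {mΩ : MeasurableSpace Ω} {P : Measure Ω} {ℱ : Filtration ℝ≥0 mΩ}

namespace IsHawkesModel

lemma path_bounds {k m : ℕ} {ω : Ω} (h : Regular T U Y ω) (hp : p.Admissible)
    (hω : ω ∈ boundedMarks U Y k m) {u : ℝ} (hu : (prevArrival T k ω : ℝ) ≤ u) :
    0 ≤ u ∧ (∀ i < k, (path T U Y ω).1 i ≤ u) ∧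
      intensityAt p k u (path T U Y ω) ≤ p.lam + k * m := by
  have h0 : 0 ≤ u := (NNReal.coe_nonneg _).trans hu
  have h1 : ∀ i < k, (path T U Y ω).1 i ≤ u := fun i hi =>
    le_trans (by exact_mod_cast h.le_prevArrival hi) hu
  exact ⟨h0, h1, (le_abs_self _).trans (abs_intensityAt_le hp h0 h1 fun i hi => (hω i hi).2)⟩

lemma exists_bound_expVal (hm : IsHawkesModel p P ℱ T U Y) (hp : p.Admissible) (r : ℝ)
    (k : ℕ) (t : ℝ≥0) (m : ℕ) : ∃ C : ℝ≥0, ∀ᵐ ω ∂P, ω ∈ boundedMarks U Y k m →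
      ∀ u : ℝ, (prevArrival T k ω : ℝ) ≤ u → u ≤ t →
        ENNReal.ofReal (intensityAt p k u (path T U Y ω)) * expVal p r k (u, path T U Y ω) ≤ C := by
  obtain ⟨C, hC⟩ := exists_expAt_le hp r k m t
  refine ⟨Real.toNNReal (p.lam + k * m) * Real.toNNReal C, ?_⟩
  filter_upwards [hm.ae_regular hp] with ω h hω u hu hut
  obtain ⟨h0, h1, h2⟩ := path_bounds h hp hω hu
  rw [ENNReal.coe_mul]
  exact mul_le_mul' (ENNReal.ofReal_le_ofReal h2) (ENNReal.ofReal_le_ofReal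
    (hC u _ h0 hut h1 (fun i hi => (hω i hi).1) fun i hi => (hω i hi).2))

lemma exists_bound_wtVal (hm : IsHawkesModel p P ℱ T U Y) (hp : p.Admissible) (r : ℝ)
    (k : ℕ) (t : ℝ≥0) (m : ℕ) : ∃ C : ℝ≥0, ∀ᵐ ω ∂P, ω ∈ boundedMarks U Y k m →
      ∀ u : ℝ, (prevArrival T k ω : ℝ) ≤ u → u ≤ t →
        ENNReal.ofReal (intensityAt p k u (path T U Y ω)) * wtVal p r k (u, path T U Y ω) ≤ C := by
  obtain ⟨C, hC⟩ := exists_expAt_le hp r k m t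
  refine ⟨Real.toNNReal (p.lam + k * m) * Real.toNNReal (C * (p.lam + k * m)), ?_⟩
  filter_upwards [hm.ae_regular hp] with ω h hω u hu hut
  obtain ⟨h0, h1, h2⟩ := path_bounds h hp hω hu
  have h3 := hC u _ h0 hut h1 (fun i hi => (hω i hi).1) fun i hi => (hω i hi).2
  have h4 := h.intensityAt_nonneg hp k u
  have h5 : Real.exp (-p.growth r * u) ≤ 1 := by
    refine Real.exp_le_one_iff.2 ?_
    have : 0 ≤ p.growth r := add_nonneg Params.jumpMean_nonneg hp.jumpShockMean_nonneg
    nlinarith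
  rw [ENNReal.coe_mul]
  refine mul_le_mul' (ENNReal.ofReal_le_ofReal h2) (ENNReal.ofReal_le_ofReal ?_)
  refine mul_le_mul h3 ((mul_le_of_le_one_right h4 h5).trans h2) (by positivity)
    ((expAt_nonneg _).trans h3)

variable [IsProbabilityMeasure P]

lemma stage_expVal (hm : IsHawkesModel p P ℱ T U Y) (hp : p.Admissible) (hα : p.AlphaDefined r)
    {A : Set Ω} {s t : ℝ≥0} (hst : s ≤ t) (hA : MeasurableSet[ℱ s] A) (k : ℕ) :
    ∫⁻ ω in A, aliveTerm T U Y (expVal p r k) k t ω ∂P +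
        ∫⁻ ω in A, startTerm T U Y (expVal p r (k + 1)) (k + 1) s t ω ∂P =
      ∫⁻ ω in A, aliveTerm T U Y (expVal p r k) k s ω ∂P +
        ∫⁻ ω in A, startTerm T U Y (expVal p r k) k s t ω ∂P := by
  rw [← lintegral_add_left (hm.measurable_aliveTerm measurable_expVal k t),
    ← lintegral_add_left (hm.measurable_aliveTerm measurable_expVal k s)]
  simp only [← jumpTerm_expJump]
  refine le_antisymm (hm.stage_le hp hst hA k measurable_expVal dependsOnFirst_expVal
    measurable_expJump dependsOnFirst_expJump (hm.exists_bound_expVal hp r k t) ?_)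
    (hm.le_stage hp hst hA k measurable_expVal dependsOnFirst_expVal
    measurable_expJump dependsOnFirst_expJump (hm.exists_bound_expVal hp r k t) ?_)
  · filter_upwards [hm.ae_regular hp] with ω h l v _ hlv _
    exact (expVal_balance hp hα (fun i _ => (h.shock_pos i).le) hlv).le
  · filter_upwards [hm.ae_regular hp] with ω h l v _ hlv _
    exact (expVal_balance hp hα (fun i _ => (h.shock_pos i).le) hlv).ge

/-- Telescoped `stage_expVal`. The remainder is the mass carried past the `n`-th arrival; it is zero
for `n = 0` because `(s, t]` omits time `0`. -/
lemma sum_aliveTerm (hm : IsHawkesModel p P ℱ T U Y) (hp : p.Admissible) (hα : p.AlphaDefined r)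
    {A : Set Ω} {s t : ℝ≥0} (hst : s ≤ t) (hA : MeasurableSet[ℱ s] A) (n : ℕ) :
    ∑ k ∈ Finset.range n, ∫⁻ ω in A, aliveTerm T U Y (expVal p r k) k t ω ∂P +
        ∫⁻ ω in A, startTerm T U Y (expVal p r n) n s t ω ∂P =
      ∑ k ∈ Finset.range n, ∫⁻ ω in A, aliveTerm T U Y (expVal p r k) k s ω ∂P := by
  induction n with
  | zero => simp [startTerm_zero]
  | succ n ih =>
    rw [Finset.sum_range_succ, Finset.sum_range_succ, add_assoc, hm.stage_expVal hp hα hst hA n,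
      ← ih]
    ring

/-- Each arrival before `t` uses up at least `exp(-γt)` times the current mass of `M`. -/
lemma stage_wtVal (hm : IsHawkesModel p P ℱ T U Y) (hp : p.Admissible) (hα : p.AlphaDefined r)
    (t : ℝ≥0) (k : ℕ) :
    ∫⁻ ω, startTerm T U Y (wtVal p r (k + 1)) (k + 1) 0 t ω ∂P +
        ENNReal.ofReal (Real.exp (-p.growth r * t)) *
          ∫⁻ ω, startTerm T U Y (expVal p r (k + 1)) (k + 1) 0 t ω ∂P ≤
      ∫⁻ ω, aliveTerm T U Y (wtVal p r k) k 0 ω ∂P +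
        ∫⁻ ω, startTerm T U Y (wtVal p r k) k 0 t ω ∂P := by
  have h := hm.stage_le hp (zero_le : 0 ≤ t) (@MeasurableSet.univ _ (ℱ 0)) k measurable_wtVal
    dependsOnFirst_wtVal (measurable_wtJump (p := p) (r := r) (t : ℝ)) (dependsOnFirst_wtJump _)
    (hm.exists_bound_wtVal hp r k t) (by
      filter_upwards [hm.ae_regular hp] with ω h l v _ hlv hvt
      exact wtVal_balance hp hα (fun i _ => (h.shock_pos i).le) hlv hvt)
  simp only [Measure.restrict_univ] at h
  rw [← lintegral_const_mul _ (hm.measurable_startTerm measurable_expVal _ _ _),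
    ← lintegral_add_left (hm.measurable_startTerm measurable_wtVal _ _ _),
    ← lintegral_add_left (hm.measurable_aliveTerm measurable_wtVal k 0)]
  refine le_trans (lintegral_mono_ae ?_) h
  filter_upwards [hm.ae_regular hp] with ω hω
  rw [hω.jumpTerm_wtJump hp]
  exact le_add_self

lemma sum_startTerm_le (hm : IsHawkesModel p P ℱ T U Y) (hp : p.Admissible)
    (hα : p.AlphaDefined r) (t : ℝ≥0) (n : ℕ) :
    ∫⁻ ω, startTerm T U Y (wtVal p r n) n 0 t ω ∂P +
        ENNReal.ofReal (Real.exp (-p.growth r * t)) * ∑ k ∈ Finset.range n,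
          ∫⁻ ω, startTerm T U Y (expVal p r (k + 1)) (k + 1) 0 t ω ∂P ≤
      ∑ k ∈ Finset.range n, ∫⁻ ω, aliveTerm T U Y (wtVal p r k) k 0 ω ∂P := by
  induction n with
  | zero => simp [startTerm_zero]
  | succ n ih =>
    rw [Finset.sum_range_succ, Finset.sum_range_succ, mul_add]
    calc _ = (∫⁻ ω, startTerm T U Y (wtVal p r (n + 1)) (n + 1) 0 t ω ∂P +
          ENNReal.ofReal (Real.exp (-p.growth r * t)) *
            ∫⁻ ω, startTerm T U Y (expVal p r (n + 1)) (n + 1) 0 t ω ∂P) +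
          ENNReal.ofReal (Real.exp (-p.growth r * t)) * ∑ k ∈ Finset.range n,
            ∫⁻ ω, startTerm T U Y (expVal p r (k + 1)) (k + 1) 0 t ω ∂P := by ring
      _ ≤ _ := add_le_add_left (hm.stage_wtVal hp hα t n) _
      _ = ∫⁻ ω, aliveTerm T U Y (wtVal p r n) n 0 ω ∂P +
          (∫⁻ ω, startTerm T U Y (wtVal p r n) n 0 t ω ∂P +
          ENNReal.ofReal (Real.exp (-p.growth r * t)) * ∑ k ∈ Finset.range n,
            ∫⁻ ω, startTerm T U Y (expVal p r (k + 1)) (k + 1) 0 t ω ∂P) := by ring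
      _ ≤ _ := add_le_add_right ih _
      _ = _ := add_comm _ _

/-- Almost surely nothing has arrived at time `0`, so the whole Lyapunov budget is the initial
intensity. -/
lemma lintegral_aliveTerm_wtVal_zero (hm : IsHawkesModel p P ℱ T U Y) (hp : p.Admissible)
    (k : ℕ) :
    ∫⁻ ω, aliveTerm T U Y (wtVal p r k) k 0 ω ∂P ≤ if k = 0 then ENNReal.ofReal p.lam else 0 := by
  split_ifs with hk
  · subst hk
    calc _ ≤ ∫⁻ _, ENNReal.ofReal p.lam ∂P := lintegral_mono fun ω =>
          (Set.indicator_le_self' (fun _ _ => zero_le) ω).trans (by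
            simp [wtVal, expAt_zero_zero, intensityAt_zero_zero])
      _ = _ := by simp
  · refine (lintegral_eq_zero_of_ae_eq_zero ?_).le
    filter_upwards [hm.ae_regular hp] with ω h
    refine Set.indicator_of_notMem (fun h' => ?_) _
    exact (h.first_pos.trans_le (h.le_prevArrival (Nat.pos_of_ne_zero hk))).not_ge h'.1

/-- Each partial sum costs at most the initial budget `λ`, uniformly in the number of stages. -/
lemma tsum_startTerm_ne_top (hm : IsHawkesModel p P ℱ T U Y) (hp : p.Admissible)
    (hα : p.AlphaDefined r) (t : ℝ≥0) :
    ∑' k, ∫⁻ ω, startTerm T U Y (expVal p r (k + 1)) (k + 1) 0 t ω ∂P ≠ ⊤ := by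
  set ε := ENNReal.ofReal (Real.exp (-p.growth r * t))
  have hε : ε ≠ 0 := by simpa [ε] using Real.exp_pos _
  have hle : ε * ∑' k, ∫⁻ ω, startTerm T U Y (expVal p r (k + 1)) (k + 1) 0 t ω ∂P ≤
      ENNReal.ofReal p.lam := by
    rw [← ENNReal.tsum_mul_left, ENNReal.tsum_eq_iSup_nat]
    refine iSup_le fun n => ?_
    rw [← Finset.mul_sum]
    refine le_add_self.trans ((hm.sum_startTerm_le hp hα t n).trans ?_)
    refine (Finset.sum_le_sum fun k _ => hm.lintegral_aliveTerm_wtVal_zero hp k).trans ?_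
    rw [Finset.sum_ite_eq']
    split_ifs <;> simp
  intro htop
  rw [htop, ENNReal.mul_top hε] at hle
  exact ENNReal.ofReal_ne_top (top_le_iff.1 hle)

/-- The exponential process has constant expectation on events of the past. -/
lemma setLIntegral_expMart (hm : IsHawkesModel p P ℱ T U Y) (hp : p.Admissible)
    (hα : p.AlphaDefined r) {A : Set Ω} {s t : ℝ≥0} (hst : s ≤ t) (hA : MeasurableSet[ℱ s] A) :
    ∫⁻ ω in A, ENNReal.ofReal (expMart p T U Y r t ω) ∂P =
      ∫⁻ ω in A, ENNReal.ofReal (expMart p T U Y r s ω) ∂P := by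
  have hsum : ∀ u, ∫⁻ ω in A, ENNReal.ofReal (expMart p T U Y r u ω) ∂P =
      ∑' k, ∫⁻ ω in A, aliveTerm T U Y (expVal p r k) k u ω ∂P := fun u => by
    rw [← lintegral_tsum fun k => (hm.measurable_aliveTerm measurable_expVal k u).aemeasurable]
    refine lintegral_congr_ae (ae_restrict_of_ae ?_)
    filter_upwards [hm.ae_regular hp] with ω h using (h.tsum_aliveTerm u).symm
  rw [hsum, hsum]
  have hlim : Tendsto (fun n => ∫⁻ ω in A, startTerm T U Y (expVal p r n) n s t ω ∂P)
      atTop (𝓝 0) := by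
    -- The convergent series starts at index `k + 1` and counts arrivals in `(0, t]`, which
    -- dominates `(s, t]`.
    rw [← tendsto_add_atTop_iff_nat 1]
    refine tendsto_of_tendsto_of_tendsto_of_le_of_le tendsto_const_nhds
      (ENNReal.tendsto_atTop_zero_of_tsum_ne_top (hm.tsum_startTerm_ne_top hp hα t))
      (fun _ => zero_le) fun n => ?_
    exact (setLIntegral_le_lintegral _ _).trans (lintegral_mono fun ω => startTerm_mono _ _ _ _ _)
  have h1 := (ENNReal.tendsto_nat_tsum
    fun k => ∫⁻ ω in A, aliveTerm T U Y (expVal p r k) k t ω ∂P).add hlim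
  rw [add_zero] at h1
  refine tendsto_nhds_unique h1 ?_
  simp only [hm.sum_aliveTerm hp hα hst hA]
  exact ENNReal.tendsto_nat_tsum _

lemma lintegral_expMart (hm : IsHawkesModel p P ℱ T U Y) (hp : p.Admissible)
    (hα : p.AlphaDefined r) (t : ℝ≥0) :
    ∫⁻ ω, ENNReal.ofReal (expMart p T U Y r t ω) ∂P = 1 := by
  have h := hm.setLIntegral_expMart hp hα (zero_le : 0 ≤ t) (@MeasurableSet.univ _ (ℱ 0))
  simp only [Measure.restrict_univ] at h
  rw [h, lintegral_congr_ae (g := fun _ => 1), lintegral_one, measure_univ]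
  filter_upwards [hm.ae_regular hp] with ω h
  rw [expMart_eq, h.count_eq (k := 0) (t := 0) le_rfl h.first_pos]
  simp [expAt_zero_zero]

end IsHawkesModel
end HawkesRisk

/-! ### Path regularity, martingale property and change of measure -/

namespace HawkesRisk

section Trajectories

variable {Ω : Type*} {T : ℕ → Ω → ℝ≥0} {U Y : ℕ → Ω → ℝ} {p : Params} {r : ℝ}

lemma expMart_nonneg (t : ℝ≥0) (ω : Ω) : 0 ≤ expMart p T U Y r t ω := by
  unfold expMart; positivity

lemma Regular.cadlag {ω : Ω} (h : Regular T U Y ω) (t : ℝ≥0) :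
    ContinuousWithinAt (fun s => expMart p T U Y r s ω) (Set.Ici t) t ∧
      ∃ l, Tendsto (fun s => expMart p T U Y r s ω) (𝓝[<] t) (𝓝 l) := by
  have hcont : ∀ k, Continuous fun s : ℝ≥0 => expAt p r k s (path T U Y ω) := fun k =>
    continuous_expAt.comp NNReal.continuous_coe
  obtain ⟨k, h1, h2⟩ := h.exists_count t
  have heq : ∀ k s, prevArrival T k ω ≤ s → s < T k ω →
      expMart p T U Y r s ω = expAt p r k s (path T U Y ω) := fun k s h1 h2 => by
    rw [expMart_eq, h.count_eq h1 h2]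
  constructor
  · refine (hcont k).continuousWithinAt.congr_of_eventuallyEq ?_ (heq k t h1 h2)
    filter_upwards [self_mem_nhdsWithin, mem_nhdsWithin_of_mem_nhds (Iio_mem_nhds h2)]
      with s hs hs'
    exact heq k s (h1.trans hs) hs'
  · rcases eq_or_ne t 0 with rfl | ht
    -- No time precedes `0` in `ℝ≥0`, so the filter is trivial and any limit serves.
    · exact ⟨0, by
        have : Set.Iio (0 : ℝ≥0) = ∅ := by ext; simp
        rw [this, nhdsWithin_empty]
        exact tendsto_bot⟩
    -- At an arrival time the left limit belongs to the stage that is just ending.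
    · obtain ⟨j, hj1, hj2⟩ : ∃ j, prevArrival T j ω < t ∧ t ≤ T j ω := by
        rcases h1.lt_or_eq with h1 | h1
        · exact ⟨k, h1, h2.le⟩
        · cases k with
          | zero => exact absurd h1.symm ht
          | succ j => exact ⟨j, (h.prevArrival_lt j).trans_eq h1, h1.ge⟩
      refine ⟨expAt p r j t (path T U Y ω),
        (((hcont j).tendsto t).mono_left nhdsWithin_le_nhds).congr' ?_⟩
      filter_upwards [self_mem_nhdsWithin, mem_nhdsWithin_of_mem_nhds (Ioi_mem_nhds hj1)]
        with s hs hs'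
      exact (heq j s (le_of_lt hs') (lt_of_lt_of_le hs hj2)).symm

/-- The trajectory up to and including time `t`; later entries are set to `0`. -/
noncomputable def pathUpTo (T : ℕ → Ω → ℝ≥0) (U Y : ℕ → Ω → ℝ) (t : ℝ≥0) (ω : Ω) : MarkedPath :=
  (fun i => if T i ω ≤ t then (T i ω : ℝ) else 0,
    fun i => if T i ω ≤ t then U i ω else 0,
    fun i => if T i ω ≤ t then Y i ω else 0)

end Trajectories

variable {Ω : Type*} {mΩ : MeasurableSpace Ω} {P : Measure Ω} {ℱ : Filtration ℝ≥0 mΩ}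
  {p : Params} {T : ℕ → Ω → ℝ≥0} {U Y : ℕ → Ω → ℝ} {r : ℝ}

/-- Used for adaptedness: off the regular trajectories `count` may take the default value of
`Set.ncard`, so `expMart` matches an evidently adapted process only almost surely, and completeness
of `ℱ` absorbs the difference. -/
lemma UsualConditions.measurable_congr (h : UsualConditions P ℱ) {t : ℝ≥0} {f g : Ω → ℝ}
    (hg : Measurable[ℱ t] g) (hfg : f =ᵐ[P] g) : Measurable[ℱ t] f := by
  intro B hB
  have hnull : ∀ s : Set Ω, P s = 0 → MeasurableSet[ℱ t] s := fun s hs =>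
    ℱ.mono zero_le _ (h.complete s hs)
  have hN : P {ω | f ω ≠ g ω} = 0 := hfg
  have he : f ⁻¹' B = (g ⁻¹' B \ {ω | f ω ≠ g ω}) ∪ (f ⁻¹' B ∩ {ω | f ω ≠ g ω}) := by
    ext ω
    by_cases hω : f ω = g ω <;> simp [hω]
  rw [he]
  exact @MeasurableSet.union _ (ℱ t) _ _ (@MeasurableSet.diff _ (ℱ t) _ _ (hg hB) (hnull _ hN))
    (hnull _ (measure_mono_null Set.inter_subset_right hN))

namespace IsHawkesModel

lemma measurableSet_arrival_le (hm : IsHawkesModel p P ℱ T U Y) (n : ℕ) (t : ℝ≥0) :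
    MeasurableSet[ℱ t] {ω | T n ω ≤ t} := by
  have h : {ω | T n ω ≤ t} = {ω | (T n ω : WithTop ℝ≥0) ≤ t} := by
    ext x; exact (WithTop.coe_le_coe (a := t) (b := T n x)).symm
  rw [h]
  exact hm.stopping n t

lemma measurable_upTo (hm : IsHawkesModel p P ℱ T U Y) (n : ℕ) (t : ℝ≥0) {f : Ω → ℝ}
    (hf : Measurable[(hm.stopping n).measurableSpace] f) :
    Measurable[ℱ t] fun ω => if T n ω ≤ t then f ω else 0 := by
  intro B hB
  have h1 : MeasurableSet[ℱ t] (f ⁻¹' B ∩ {ω | T n ω ≤ t}) := by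
    have h : {ω | T n ω ≤ t} = {ω | (T n ω : WithTop ℝ≥0) ≤ t} := by
      ext x; exact (WithTop.coe_le_coe (a := t) (b := T n x)).symm
    rw [h]
    exact (hf hB).2 t
  have h2 := hm.measurableSet_arrival_le n t
  by_cases h0 : (0 : ℝ) ∈ B
  · have : (fun ω => if T n ω ≤ t then f ω else 0) ⁻¹' B =
        (f ⁻¹' B ∩ {ω | T n ω ≤ t}) ∪ {ω | T n ω ≤ t}ᶜ := by
      ext ω
      by_cases hq : T n ω ≤ t <;> simp [hq, h0]
    rw [this]
    exact @MeasurableSet.union _ (ℱ t) _ _ h1 h2.compl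
  · have : (fun ω => if T n ω ≤ t then f ω else 0) ⁻¹' B = f ⁻¹' B ∩ {ω | T n ω ≤ t} := by
      ext ω
      by_cases hq : T n ω ≤ t <;> simp [hq, h0]
    rw [this]
    exact h1

lemma measurable_pathUpTo (hm : IsHawkesModel p P ℱ T U Y) (t : ℝ≥0) :
    Measurable[ℱ t] (pathUpTo T U Y t) := by
  refine @measurable_markedPath _ (ℱ t) _ _ _ (fun i => ?_) (fun i => ?_) fun i => ?_
  · exact hm.measurable_upTo i t (hm.measurable_arrival_stopping i)
  · exact hm.measurable_upTo i t (hm.claim_meas i)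
  · exact hm.measurable_upTo i t (hm.shock_meas i)

lemma measurableSet_alive (hm : IsHawkesModel p P ℱ T U Y) (k : ℕ) (t : ℝ≥0) :
    MeasurableSet[ℱ t] (prevArrival T k ⁻¹' Set.Iic t ∩ T k ⁻¹' Set.Ioi t) := by
  refine @MeasurableSet.inter _ (ℱ t) _ _ ?_ ?_
  · cases k with
    | zero =>
      have : prevArrival T 0 ⁻¹' Set.Iic t = Set.univ := by ext; simp [prevArrival]
      rw [this]
      exact @MeasurableSet.univ _ (ℱ t)
    | succ k => exact hm.measurableSet_arrival_le k t
  · have : T k ⁻¹' Set.Ioi t = {ω | T k ω ≤ t}ᶜ := by ext; simp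
    rw [this]
    exact (hm.measurableSet_arrival_le k t).compl

lemma measurable_expMart (hm : IsHawkesModel p P ℱ T U Y) (hp : p.Admissible)
    (hℱ : UsualConditions P ℱ) (r : ℝ) (t : ℝ≥0) : Measurable[ℱ t] (expMart p T U Y r t) := by
  set S : ℕ → Set Ω := fun k => prevArrival T k ⁻¹' Set.Iic t ∩ T k ⁻¹' Set.Ioi t with hS
  -- The adapted version: the stage at time `t` and the trajectory cut off at `t` are both known at
  -- `t`.
  let g : Ω → ℝ≥0∞ := fun ω => ∑' k, (S k).indicator
    (fun ω => expVal p r k (t, pathUpTo T U Y t ω)) ω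
  have hg : Measurable[ℱ t] g := by
    refine @Measurable.tsum _ _ _ (ℱ t) _ _ _ _ _ _ _ _ _ _ _ _ fun k => ?_
    refine @Measurable.indicator _ _ _ _ (ℱ t) _ _ ?_ (hm.measurableSet_alive k t)
    have h1 : Measurable[ℱ t] fun ω => ((t : ℝ), pathUpTo T U Y t ω) :=
      (@measurable_const _ _ _ (ℱ t) (t : ℝ)).prodMk (hm.measurable_pathUpTo t)
    exact measurable_expVal.comp h1
  refine hℱ.measurable_congr (g := fun ω => (g ω).toReal) hg.ennreal_toReal ?_
  filter_upwards [hm.ae_regular hp] with ω h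
  have : g ω = ENNReal.ofReal (expMart p T U Y r t ω) := by
    rw [← h.tsum_aliveTerm t]
    refine tsum_congr fun k => ?_
    by_cases hk : ω ∈ S k
    · rw [aliveTerm, Set.indicator_of_mem hk, Set.indicator_of_mem (s := _ ∩ _) hk]
      have hle : ∀ i < k, T i ω ≤ t := fun i hi => (h.le_prevArrival hi).trans hk.1
      refine dependsOnFirst_expVal (t : ℝ) (0, 0) _ _ ?_ ?_ ?_ <;> intro i hi <;>
        simp [pathUpTo, path, hle i hi]
    · rw [aliveTerm, Set.indicator_of_notMem hk, Set.indicator_of_notMem (s := _ ∩ _) hk]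
  rw [this, ENNReal.toReal_ofReal (expMart_nonneg t ω)]

lemma setIntegral_expMart (hm : IsHawkesModel p P ℱ T U Y) (hp : p.Admissible)
    (hℱ : UsualConditions P ℱ) (t : ℝ≥0) (A : Set Ω) :
    ∫ ω in A, expMart p T U Y r t ω ∂P =
      (∫⁻ ω in A, ENNReal.ofReal (expMart p T U Y r t ω) ∂P).toReal :=
  integral_eq_lintegral_of_nonneg_ae (ae_of_all _ fun ω => expMart_nonneg t ω)
    ((hm.measurable_expMart hp hℱ r t).mono (ℱ.le t) le_rfl).aestronglyMeasurable

variable [IsProbabilityMeasure P]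

lemma integrable_expMart (hm : IsHawkesModel p P ℱ T U Y) (hp : p.Admissible)
    (hℱ : UsualConditions P ℱ) (hα : p.AlphaDefined r) (t : ℝ≥0) :
    Integrable (expMart p T U Y r t) P := by
  have hmeas := (hm.measurable_expMart hp hℱ r t).mono (ℱ.le t) le_rfl
  refine ⟨hmeas.aestronglyMeasurable, ?_⟩
  rw [hasFiniteIntegral_iff_ofReal (ae_of_all _ fun ω => expMart_nonneg t ω),
    hm.lintegral_expMart hp hα t]
  exact ENNReal.one_lt_top

lemma martingale_expMart (hm : IsHawkesModel p P ℱ T U Y) (hp : p.Admissible)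
    (hℱ : UsualConditions P ℱ) (hα : p.AlphaDefined r) :
    Martingale (expMart p T U Y r) ℱ P := by
  have hmeas : StronglyAdapted ℱ (expMart p T U Y r) := fun t =>
    (hm.measurable_expMart hp hℱ r t).stronglyMeasurable
  refine ⟨hmeas, fun s t hst => ?_⟩
  refine (ae_eq_condExp_of_forall_setIntegral_eq (ℱ.le s) (hm.integrable_expMart hp hℱ hα t)
    (fun _ _ _ => (hm.integrable_expMart hp hℱ hα s).integrableOn) (fun A hA _ => ?_)
    (hmeas s).aestronglyMeasurable).symm
  rw [hm.setIntegral_expMart hp hℱ, hm.setIntegral_expMart hp hℱ,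
    hm.setLIntegral_expMart hp hα hst hA]

lemma integral_expMart (hm : IsHawkesModel p P ℱ T U Y) (hp : p.Admissible)
    (hℱ : UsualConditions P ℱ) (hα : p.AlphaDefined r) (t : ℝ≥0) :
    ∫ ω, expMart p T U Y r t ω ∂P = 1 := by
  have h := hm.setIntegral_expMart (r := r) hp hℱ t Set.univ
  rw [setIntegral_univ, setLIntegral_univ, hm.lintegral_expMart hp hα] at h
  simpa using h

/-- The true martingale property is already established, so no explicit localizing sequence has to
be built. -/
lemma isLocalMartingale_expMart (hm : IsHawkesModel p P ℱ T U Y) (hp : p.Admissible)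
    (hℱ : UsualConditions P ℱ) (hα : p.AlphaDefined r) :
    IsLocalMartingale (expMart p T U Y r) ℱ P where
  adapted := (hm.martingale_expMart hp hℱ hα).1
  cadlag := by filter_upwards [hm.ae_regular hp] with ω h t using h.cadlag t
  locally_martingale := Locally.of_prop (hm.martingale_expMart hp hℱ hα)

/-- The measures are the restrictions to `ℱ t` of `P` with density `M_t`. Consistency is the
constancy of the expectation of `M` on past events; uniqueness holds since the density formula fixes
every value. -/
lemma existsUnique_changeOfMeasure (hm : IsHawkesModel p P ℱ T U Y) (hp : p.Admissible)
    (hα : p.AlphaDefined r) :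
    ∃! Q : ∀ t : ℝ≥0, @Measure Ω (ℱ t), IsChangeOfMeasure (expMart p T U Y r) ℱ P Q := by
  have hden : ∀ t (A : Set Ω), MeasurableSet[ℱ t] A →
      (P.withDensity fun ω => ENNReal.ofReal (expMart p T U Y r t ω)).trim (ℱ.le t) A =
        ∫⁻ ω in A, ENNReal.ofReal (expMart p T U Y r t ω) ∂P := fun t A hA => by
    rw [trim_measurableSet_eq _ hA, withDensity_apply _ (ℱ.le t _ hA)]
  refine ⟨fun t => (P.withDensity fun ω => ENNReal.ofReal (expMart p T U Y r t ω)).trim (ℱ.le t),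
    ⟨fun t => ⟨?_⟩, hden, fun s t hst => ?_⟩, fun Q hQ => ?_⟩
  · rw [hden t _ (@MeasurableSet.univ _ (ℱ t)), setLIntegral_univ, hm.lintegral_expMart hp hα]
  · refine @Measure.ext _ (ℱ s) _ _ fun A hA => ?_
    rw [trim_measurableSet_eq _ hA, hden t A (ℱ.mono hst _ hA), hden s A hA,
      hm.setLIntegral_expMart hp hα hst hA]
  · funext t
    refine @Measure.ext _ (ℱ t) _ _ fun A hA => ?_
    rw [hQ.density t A hA, hden t A hA]

end IsHawkesModel
end HawkesRisk

theorem mainTheorem8 {Ω : Type*} {mΩ : MeasurableSpace Ω} (P : Measure Ω)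
    [IsProbabilityMeasure P] (ℱ : Filtration ℝ≥0 mΩ) (hℱ : HawkesRisk.UsualConditions P ℱ)
    (p : HawkesRisk.Params) (hp : p.Admissible)
    (T : ℕ → Ω → ℝ≥0) (U Y : ℕ → Ω → ℝ) (hmodel : HawkesRisk.IsHawkesModel p P ℱ T U Y)
    (R ε : ℝ) (hR : p.IsAdjustment R ε) :
    -- `α(r)` is defined for all `r ≤ R + ε`
    (∀ r, r ≤ R + ε → p.AlphaDefined r) ∧
    -- non-negative local martingale
    (∀ r, 0 ≤ r → r ≤ R + ε →
      (∀ t ω, 0 ≤ HawkesRisk.expMart p T U Y r t ω) ∧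
      HawkesRisk.IsLocalMartingale (HawkesRisk.expMart p T U Y r) ℱ P) ∧
    -- true martingale with mean one, which defines a change of measure
    (∀ r, r < R + ε →
      Martingale (HawkesRisk.expMart p T U Y r) ℱ P ∧
      (∀ t, ∫ ω, HawkesRisk.expMart p T U Y r t ω ∂P = 1) ∧
      ∃! Q : ∀ t : ℝ≥0, @Measure Ω (ℱ t),
        HawkesRisk.IsChangeOfMeasure (HawkesRisk.expMart p T U Y r) ℱ P Q) := by
  have hα : ∀ r, r ≤ R + ε → p.AlphaDefined r := fun r hr =>
    HawkesRisk.Params.alphaDefined_of_le hp hr hR.alpha_add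
  exact ⟨hα,
    fun r _ hr => ⟨HawkesRisk.expMart_nonneg, hmodel.isLocalMartingale_expMart hp hℱ (hα r hr)⟩,
    fun r hr => ⟨hmodel.martingale_expMart hp hℱ (hα r hr.le),
      hmodel.integral_expMart hp hℱ (hα r hr.le),
      hmodel.existsUnique_changeOfMeasure hp (hα r hr.le)⟩⟩
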